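/- Let $p$ be a prime, $q=p^l$ with $l\ge 1$, and $m\ge 2$. Write $\mathrm{Tr}$ for the trace map from $\mathbb{F}_{q^m}$ to $\mathbb{F}_q$. Let $\mathcal{C}$ be the linear code over $\mathbb{F}_{q^m}$ generated by the rows of the matrix with three rows whose columns are $(0,1,0)^\top$ and $(1,x,y)^\top$, one for each pair $(x,y)\in\mathbb{F}_{q^m}^2$ with $\mathrm{Tr}(x)+\mathrm{Tr}(y^2)=0$. Let $A_w$ be the number of codewords of $\mathcal{C}$ of Hamming weight $w$; a code is called a $t$-weight code if exactly $t$ of the numbers $A_1,\dots,A_n$ are nonzero, where $n$ is its length; an $[n,k,d]$ code (length $n$, dimension $k$, minimum distance $d$) is called almost MDS if $d=n-k$. 1. If $q$ is even, then $\mathcal{C}$ is a five-weight code with parameters $[q^{2m-1}+1,\,3,\,q^{2m-1}-2q^{m-1}+1]$ and weight distribution $$\begin{array}{c|c}\text{Weight}&\text{Multiplicity}\\\hline 0&1\\ q^{2m-1}-2q^{m-1}+1&\frac{q^m}{2}(q^m-1)(q-1)\\ q^{2m-1}-q^{m-1}&q^m(q^m-1)\\ q^{2m-1}-q^{m-1}+1&q^m(q^m-1)(q^m-q+1)\\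 q^{2m-1}&q^m-1\\ q^{2m-1}+1&\frac{q^m}{2}(q^m-1)(q-1)\end{array}$$ 2. If $q$ and $m$ are both odd, then $\mathcal{C}$ is a five-weight code with parameters $[q^{2m-1}+1,\,3,\,q^{2m-1}-q^{m-1}-q^{\frac{m-1}{2}}+1]$ and weight distribution $$\begin{array}{c|c}\text{Weight}&\text{Multiplicity}\\\hline 0&1\\ q^{2m-1}-q^{m-1}-q^{\frac{m-1}{2}}+1&\frac{q^{2m-1}(q^m-1)(q-1)}{2}\\ q^{2m-1}-q^{m-1}&q^m(q^m-1)\\ q^{2m-1}-q^{m-1}+1&q^{2m-1}(q^m-1)\\ q^{2m-1}-q^{m-1}+q^{\frac{m-1}{2}}+1&\frac{q^{2m-1}(q^m-1)(q-1)}{2}\\ q^{2m-1}&q^m-1\end{array}$$ 3. If $q$ is odd and $m$ is even, then $\mathcal{C}$ has parameters $[q^{2m-1}+1,\,3]$ and weight distribution $$\begin{array}{c|c}\text{Weight}&\text{Multiplicity}\\\hline 0&1\\ q^{2m-1}-q^{m-1}+(q-1)q^{\frac{m-2}{2}}(-1)^{\frac{lm(p-1)}{4}}+1&q^{2m-1}(q^m-1)\\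 q^{2m-1}-q^{m-1}+q^{\frac{m-2}{2}}(-1)^{\frac{lm(p-1)+4}{4}}+1&(q^{2m}-q^{2m-1})(q^m-1)\\ q^{2m-1}-q^{m-1}&q^m(q^m-1)\\ q^{2m-1}&q^m-1\end{array}$$ where the multiplicities of rows with equal weights are added. It is a four-weight code, except when $m=2$ and $q\equiv 1\pmod 4$; in that case rows of the table coincide in pairs and $\mathcal{C}$ is a two-weight code. 4. In all cases the dual code $\mathcal{C}^{\perp}$ is a $[q^{2m-1}+1,\,q^{2m-1}-2,\,3]$ almost MDS code. -/

import Mathlib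

namespace LinearCode

section Basic

variable {F ι : Type*} [Field F] [Fintype ι]

/-- The dual code: all vectors whose standard dot product with every codeword vanishes. -/
def dual (C : Submodule F (ι → F)) : Submodule F (ι → F) where
  carrier := {x | ∀ c ∈ C, x ⬝ᵥ c = 0}
  zero_mem' := fun c _ => zero_dotProduct c
  add_mem' := fun {x y} hx hy c hc => by rw [add_dotProduct, hx c hc, hy c hc, add_zero]
  smul_mem' := fun a x hx c hc => by rw [smul_dotProduct, hx c hc, smul_zero]

/-- `C` is an `[n, k]` linear code: length `n` and dimension `k`. -/
def HasParams (C : Submodule F (ι → F)) (n k : ℕ) : Prop :=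
  Fintype.card ι = n ∧ Module.finrank F C = k

variable [DecidableEq F]

/-- `d` is the minimum Hamming distance between distinct codewords of `C`. -/
def HasMinDist (C : Submodule F (ι → F)) (d : ℕ) : Prop :=
  IsLeast {r : ℕ | ∃ c ∈ C, ∃ c' ∈ C, c ≠ c' ∧ hammingDist c c' = r} d

/-- `A_w`: the number of codewords of Hamming weight `w`. -/
noncomputable def weightCount (C : Submodule F (ι → F)) (w : ℕ) : ℕ :=
  Set.ncard {c : ι → F | c ∈ C ∧ hammingNorm c = w}

/-- `C` is a `t`-weight code: exactly `t` of the numbers `A_1, …, A_n` are nonzero. -/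
def IsWeightCode (C : Submodule F (ι → F)) (t : ℕ) : Prop :=
  ((Finset.Icc 1 (Fintype.card ι)).filter fun w => weightCount C w ≠ 0).card = t

/-- The table `T` of pairs (weight, multiplicity) is the weight distribution of `C`:
for every `w`, `A_w` is the sum of the multiplicities of the rows whose weight is `w`
(hence it is `0` if `w` does not occur). -/
def HasWeightTable (C : Submodule F (ι → F)) (T : List (ℤ × ℚ)) : Prop :=
  ∀ w : ℕ, (weightCount C w : ℚ) = ((T.filter fun r => r.1 = (w : ℤ)).map Prod.snd).sum

/-- Almost MDS: an `[n, k, d]` code with `d = n - k`. -/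
def IsAlmostMDS (C : Submodule F (ι → F)) : Prop :=
  ∃ d : ℕ, HasMinDist C d ∧ d + Module.finrank F C = Fintype.card ι

end Basic

section Construction

variable {L : Type*} [Field L]

/-- The columns of `G_{f,g}`: one distinguished column, and one for every pair `(x, y)` with
`f x + g y = 0`. -/
abbrev Cols (f g : L → L) : Type _ := Option {p : L × L // f p.1 + g p.2 = 0}

/-- The matrix `G_{f,g}`, with first column `(0, 1, 0)` and the other columns `(1, x, y)`. -/
def genMatrix (f g : L → L) : Matrix (Fin 3) (Cols f g) L :=
  Matrix.of fun i j =>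
    match j with
    | none => ![0, 1, 0] i
    | some p => ![1, p.1.1, p.1.2] i

/-- The code `C_{f,g} = {u G_{f,g} : u ∈ L³}`, the row space of `G_{f,g}`. -/
def code (f g : L → L) : Submodule L (Cols f g → L) :=
  LinearMap.range (genMatrix f g).vecMulLinear

/-- `x ↦ Tr_{L/K}(x)`, regarded as a function from `L` to `L`. -/
noncomputable def traceFun (K L : Type*) [Field K] [Field L] [Algebra K L] (x : L) : L :=
  algebraMap K L (Algebra.trace K L x)

/-- `y ↦ Tr_{L/K}(y²)`, regarded as a function from `L` to `L`. -/
noncomputable def traceSqFun (K L : Type*) [Field K] [Field L] [Algebra K L] (y : L) : L :=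
  algebraMap K L (Algebra.trace K L (y ^ 2))

end Construction

end LinearCode

/-! Write `K = F_q`, `L = F_{q^m}`. The codeword of `u = (a, b, c)` has entry `b` at the
distinguished column and `a + b x + c y` at each point, so its weight is the number of points, plus
one if `b ≠ 0`, minus the number of points on the line `a + b x + c y = 0`
(`hammingNorm_add_lineCount`). Replacing `x` by `x + y²` turns the point set into `ker Tr × L`, of
size `q^(2m-1)`. If `b = 0` the line contains `q^(m-1)` points when `c ≠ 0`, and none when `c = 0 ≠
a`. If `b ≠ 0`, eliminating `x` leaves the number of `y` with `Tr(y² + c'y + a') = 0`, where `(a',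
c')` runs over `L²` for each `b`. Everything thus rests on the value distribution of `zeroCount`.

Even `q`: `Tr(y²) = Tr(y)²`. If `c ∉ K`, the pair `(Tr y, Tr(c y))` is equidistributed on `K²` and
the count is `q^(m-1)`. If `c = k ∈ K`, the condition is a quadratic equation in `Tr y`: it has one
root if `k = 0`, and otherwise none or two, equally often.

Odd `q`: completing the square reduces to `N(t) = #{y | Tr(y²) = t}`. For odd `m`, a nonsquare `ν`
of `K` remains one in `L`, so the deviations of `N(t)` and `N(νt)` from `q^(m-1)` are opposite; they
depend only on the square class of `t`, and the second moment of `N` gives their size without Gauss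
sums (`sum_traceSqCount_odd`). For even `m`, `L` is quadratic over a field `F` between `K` and `L`;
there `N` follows from counting solutions of `y^(2(Q-1)) = -1` with `Q = |F|`, and is carried down
by `Tr_{F/K}` (`traceSqCount_even`).

Distributions are stated as identities for sums of an arbitrary `f` over the values, so coinciding
weights need no separate treatment. For the dual, distinct columns are linearly independent in
pairs, while `(0,1,0)`, `(1,0,0)`, `(1,x,0)` with `Tr x = 0` are dependent. -/

namespace LinearCode

open Finset

/-! ### Equidistribution of surjective additive maps. -/

section Fibers

/-- Summing a function of the value of a surjective additive map. -/
lemma card_mul_sum_comp {V W : Type*} [AddCommGroup V] [AddCommGroup W] [Fintype V] [Fintype W]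
    (φ : V →+ W) (hφ : Function.Surjective φ) (f : W → ℚ) :
    (Fintype.card W : ℚ) * ∑ v, f (φ v) = Fintype.card V * ∑ w, f w := by
  have h1 : ∀ w, ∑ v, f (φ v + w) = ∑ v, f (φ v) := by
    intro w
    obtain ⟨v0, rfl⟩ := hφ w
    simp_rw [← map_add]
    exact Fintype.sum_equiv (Equiv.addRight v0) _ _ fun _ => rfl
  -- The double sum over `v` and `w` is evaluated twice: translation by `w` lifts to `V`, and
  -- translation by `φ v` permutes `W`.
  have h2 : ∑ w, ∑ v, f (φ v + w) = Fintype.card W * ∑ v, f (φ v) := by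
    simp [h1]
  have h3 : ∀ v, ∑ w, f (φ v + w) = ∑ w, f w := fun v =>
    Fintype.sum_equiv (Equiv.addLeft (φ v)) _ _ fun _ => rfl
  rw [← h2, sum_comm]
  simp [h3]

/-- The fibres of a surjective additive map all have the same cardinality. -/
lemma card_mul_card_fiber {V W : Type*} [AddCommGroup V] [AddCommGroup W] [Fintype V] [Fintype W]
    (φ : V →+ W) (hφ : Function.Surjective φ) (w : W) :
    Fintype.card W * Nat.card {v // φ v = w} = Fintype.card V := by
  classical
  have h := card_mul_sum_comp φ hφ fun x => if x = w then 1 else 0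
  have h' : ∑ v, (if φ v = w then (1 : ℚ) else 0) = Nat.card {v // φ v = w} := by
    rw [sum_boole, Nat.card_eq_fintype_card, Fintype.card_subtype]
  rw [h', sum_ite_eq' univ w] at h
  simp only [mem_univ, if_true, mul_one] at h
  exact_mod_cast h

lemma sum_comp_eq_sum_card_mul {α β : Type*} [Fintype α] [Fintype β] (g : α → β) (f : β → ℚ) :
    ∑ a, f (g a) = ∑ b, (Nat.card {a // g a = b} : ℚ) * f b := by
  classical
  rw [← sum_fiberwise univ g]
  refine sum_congr rfl fun b _ => ?_
  rw [sum_congr rfl (g := fun _ => f b) fun a ha => by rw [(mem_filter.1 ha).2], sum_const,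
    nsmul_eq_mul, Nat.card_eq_fintype_card, Fintype.card_subtype]

end Fibers

/-! ### Fibres of the trace and of pairs of trace forms. -/

section Trace

variable (K L : Type*) [Field K] [Fintype K] [Field L] [Fintype L] [Algebra K L]

lemma card_mul_sum_trace (f : K → ℚ) :
    (Fintype.card K : ℚ) * ∑ x, f (Algebra.trace K L x) = Fintype.card L * ∑ t, f t :=
  card_mul_sum_comp (Algebra.trace K L).toAddMonoidHom (Algebra.trace_surjective K L) f

lemma card_mul_card_trace_fiber (t : K) :
    Fintype.card K * Nat.card {x : L // Algebra.trace K L x = t} = Fintype.card L :=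
  card_mul_card_fiber (Algebra.trace K L).toAddMonoidHom (Algebra.trace_surjective K L) t

variable {K L}

lemma card_mul_card_trace_mul_fiber {u : L} (hu : u ≠ 0) (t : K) :
    Fintype.card K * Nat.card {x : L // Algebra.trace K L (u * x) = t} = Fintype.card L := by
  rw [← card_mul_card_trace_fiber K L t]
  congr 1
  exact Nat.card_congr ((Equiv.mulLeft₀ u hu).subtypeEquiv fun x => by simp)

/-- For `c ∉ K` the map `y ↦ (Tr y, Tr (c y))` is onto `K²`. -/
lemma trace_pair_surjective {c : L} (hc : c ∉ Set.range (algebraMap K L)) :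
    Function.Surjective fun y : L => (Algebra.trace K L y, Algebra.trace K L (c * y)) := by
  let φ : L →ₗ[K] K × K := (Algebra.trace K L).prod
    ((Algebra.trace K L).comp (LinearMap.mulLeft K c))
  change Function.Surjective φ
  rw [← LinearMap.range_eq_top]
  by_contra hne
  -- A proper image is killed by a nonzero functional `g`. Nondegeneracy of the trace form turns
  -- this into `g (1, 0) + g (0, 1) c = 0`, which would put `c` in `K`.
  obtain ⟨g, hg0, hg⟩ := Submodule.exists_le_ker_of_lt_top _ (lt_top_iff_ne_top.2 hne)
  have hval : ∀ a b : K, g (a, b) = a * g (1, 0) + b * g (0, 1) := by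
    intro a b
    have : ((a, b) : K × K) = a • (1, 0) + b • (0, 1) := by simp
    rw [this, map_add, map_smul, map_smul, smul_eq_mul, smul_eq_mul]
  have hz : ∀ y : L,
      Algebra.trace K L ((algebraMap K L (g (1, 0)) + algebraMap K L (g (0, 1)) * c) * y) = 0 := by
    intro y
    have h1 : g (φ y) = 0 := hg ⟨y, rfl⟩
    have h2 : φ y = (Algebra.trace K L y, Algebra.trace K L (c * y)) := rfl
    rw [h2, hval] at h1
    have h3 : (algebraMap K L (g (1, 0)) + algebraMap K L (g (0, 1)) * c) * y =
      g (1, 0) • y + g (0, 1) • (c * y) := by simp only [Algebra.smul_def]; ring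
    rw [h3, map_add, map_smul, map_smul, smul_eq_mul, smul_eq_mul]
    linear_combination h1
  have h0 : algebraMap K L (g (1, 0)) + algebraMap K L (g (0, 1)) * c = 0 :=
    (traceForm_nondegenerate K L).1 _ hz
  by_cases hb : g (0, 1) = 0
  · rw [hb, map_zero, zero_mul, add_zero, map_eq_zero] at h0
    apply hg0
    ext1 <;> ext <;> simp [h0, hb]
  · apply hc
    have hb' : algebraMap K L (g (0, 1)) ≠ 0 := by simpa using hb
    refine ⟨-g (1, 0) / g (0, 1), ?_⟩
    rw [map_div₀, map_neg, div_eq_iff hb']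
    linear_combination -h0

end Trace

/-! ### Values of `Tr(y²)` for odd `q` and odd degree. -/

section OddDegree

variable {K L : Type*} [Field K] [Fintype K] [Field L] [Fintype L] [Algebra K L]

variable (K L) in
/-- The number of `y ∈ L` with `Tr(y²) = t`. -/
noncomputable def traceSqCount (t : K) : ℕ :=
  Nat.card {y : L // Algebra.trace K L (y ^ 2) = t}

lemma ringChar_ne_two_of_odd_card {F : Type*} [Field F] [Fintype F] (h : Odd (Fintype.card F)) :
    ringChar F ≠ 2 := by
  rw [Ne, FiniteField.even_card_iff_char_two]
  rw [Nat.odd_iff] at h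
  omega

lemma two_ne_zero_of_odd_card {F : Type*} [Field F] [Fintype F] (h : Odd (Fintype.card F)) :
    (2 : F) ≠ 0 :=
  Ring.two_ne_zero (ringChar_ne_two_of_odd_card h)

lemma sum_traceSq (f : K → ℚ) :
    ∑ y : L, f (Algebra.trace K L (y ^ 2)) = ∑ t, (traceSqCount K L t : ℚ) * f t :=
  sum_comp_eq_sum_card_mul _ _

/-- Squares and nonsquares together cover every element twice. -/
lemma sum_sq_add_sum_nonsquare_mul_sq {F : Type*} [Field F] [Fintype F]
    (hF : Odd (Fintype.card F)) {ν : F} (hν : ¬ IsSquare ν) (f : F → ℚ) :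
    ∑ y, f (y ^ 2) + ∑ y, f (ν * y ^ 2) = 2 * ∑ s, f s := by
  classical
  have hF' := ringChar_ne_two_of_odd_card hF
  have hν0 : ν ≠ 0 := by rintro rfl; exact hν (IsSquare.zero)
  have hcount : ∀ s : F, (Nat.card {y : F // y ^ 2 = s} : ℤ) = quadraticChar F s + 1 := by
    intro s
    rw [← quadraticChar_card_sqrts hF' s, Set.toFinset_card, Nat.card_eq_fintype_card]
    rfl
  have hcount' : ∀ s : F, (Nat.card {y : F // ν * y ^ 2 = s} : ℤ) = -quadraticChar F s + 1 := by
    intro s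
    have h1 : Nat.card {y : F // ν * y ^ 2 = s} = Nat.card {y : F // y ^ 2 = ν⁻¹ * s} :=
      Nat.card_congr (Equiv.subtypeEquivRight fun y => by
        rw [eq_inv_mul_iff_mul_eq₀ hν0])
    have h2 : quadraticChar F ν⁻¹ = -1 := by
      refine quadraticChar_neg_one_iff_not_isSquare.2 fun h => hν ?_
      simpa using h.inv
    rw [h1, hcount, map_mul, h2]
    ring
  rw [sum_comp_eq_sum_card_mul (fun y : F => y ^ 2) f,
    sum_comp_eq_sum_card_mul (fun y : F => ν * y ^ 2) f, ← sum_add_distrib, mul_sum]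
  refine sum_congr rfl fun s _ => ?_
  rw [← add_mul]
  congr 1
  have := hcount s
  have := hcount' s
  have h3 : (Nat.card {y : F // y ^ 2 = s} : ℤ) + Nat.card {y : F // ν * y ^ 2 = s} = 2 := by
    linarith
  exact_mod_cast h3

/-- A nonsquare stays a nonsquare in an extension of odd degree. -/
lemma not_isSquare_algebraMap_of_odd {K L : Type*} [Field K] [Field L] [Finite L] [Algebra K L]
    (hm : Odd (Module.finrank K L)) {ν : K} (hν : ¬ IsSquare ν) :
    ¬ IsSquare (algebraMap K L ν) := by
  rintro ⟨z, hz⟩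
  obtain ⟨j, hj⟩ := hm
  have hν0 : ν ≠ 0 := by rintro rfl; exact hν (IsSquare.zero)
  -- Norms give `ν^(2j+1) = N(z)²`, so `N(z) / ν^j` is a square root of `ν` in `K`.
  have h := congrArg (Algebra.norm K) hz
  rw [Algebra.norm_algebraMap, hj, map_mul] at h
  apply hν
  refine ⟨Algebra.norm K z / ν ^ j, ?_⟩
  field_simp
  rw [sq (Algebra.norm K z), ← h]
  ring

/-- Scaling `y` by `a ∈ K` multiplies `Tr(y²)` by `a²`, so the count depends only on the square
class of `t`. -/
lemma traceSqCount_mul_sq {K L : Type*} [Field K] [Field L] [Algebra K L] (t : K) {a : K} (ha : a ≠ 0) :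
    traceSqCount K L (a ^ 2 * t) = traceSqCount K L t := by
  have ha' : algebraMap K L a ≠ 0 := by simpa using ha
  refine (Nat.card_congr ((Equiv.mulLeft₀ _ ha').subtypeEquiv fun y => ?_)).symm
  have : (Equiv.mulLeft₀ (algebraMap K L a) ha' y) ^ 2 = (a ^ 2) • y ^ 2 := by
    simp [Algebra.smul_def, mul_pow]
  rw [this, map_smul, smul_eq_mul]
  exact (mul_right_injective₀ (pow_ne_zero 2 ha)).eq_iff.symm

/-- In the covering of `L` by the `y²` and the `ν y²`, the elements of trace `ν t` are hit by `y²`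
when `Tr(y²) = ν t`, and by `ν y²` when `Tr(y²) = t`. -/
lemma traceSqCount_add (hK : Odd (Fintype.card K)) (hm : Odd (Module.finrank K L)) {ν : K}
    (hν : ¬ IsSquare ν) (t : K) :
    Fintype.card K * (traceSqCount K L t + traceSqCount K L (ν * t)) = 2 * Fintype.card L := by
  classical
  have hν0 : ν ≠ 0 := by rintro rfl; exact hν (IsSquare.zero)
  have hL : Odd (Fintype.card L) := by
    rw [Module.card_eq_pow_finrank (K := K)]; exact hK.pow
  have h := sum_sq_add_sum_nonsquare_mul_sq hL (not_isSquare_algebraMap_of_odd (L := L) hm hν)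
    fun s => if Algebra.trace K L s = ν * t then 1 else 0
  have h2 : ∀ y : L, Algebra.trace K L (algebraMap K L ν * y ^ 2) = ν * t ↔
      Algebra.trace K L (y ^ 2) = t := by
    intro y
    rw [← Algebra.smul_def, map_smul, smul_eq_mul]
    exact (mul_right_injective₀ hν0).eq_iff
  simp only [h2, sum_boole, ← Fintype.card_subtype, ← Nat.card_eq_fintype_card] at h
  have h3 := card_mul_card_trace_fiber K L (ν * t)
  rw [← h3, traceSqCount, traceSqCount]
  have h4 : Nat.card {y : L // Algebra.trace K L (y ^ 2) = ν * t} +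
    Nat.card {y : L // Algebra.trace K L (y ^ 2) = t} =
      2 * Nat.card {y : L // Algebra.trace K L y = ν * t} := by exact_mod_cast h
  rw [Nat.add_comm, h4]
  ring

/-- The number of pairs with `Tr(u v) = 0`. -/
lemma card_mul_sum_traceSqCount_sq (hK : Odd (Fintype.card K)) :
    (Fintype.card K : ℚ) * ∑ t, (traceSqCount K L t : ℚ) ^ 2 =
      Fintype.card K * Fintype.card L + (Fintype.card L - 1) * Fintype.card L := by
  classical
  have hL : Odd (Fintype.card L) := by
    rw [Module.card_eq_pow_finrank (K := K)]; exact hK.pow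
  have h2 : (2 : L) ≠ 0 := two_ne_zero_of_odd_card hL
  have h1 : ∑ t, (traceSqCount K L t : ℚ) ^ 2 =
      ∑ y : L, ∑ z : L,
        if Algebra.trace K L (z ^ 2) = Algebra.trace K L (y ^ 2) then (1 : ℚ) else 0 := by
    simp only [sum_boole, ← Fintype.card_subtype, ← Nat.card_eq_fintype_card]
    simp only [sq (traceSqCount K L _ : ℚ)]
    exact (sum_traceSq fun t => (traceSqCount K L t : ℚ)).symm
  have h3 : ∑ y : L, ∑ z : L,
        (if Algebra.trace K L (z ^ 2) = Algebra.trace K L (y ^ 2) then (1 : ℚ) else 0) =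
      ∑ u : L, ∑ v : L, if Algebra.trace K L (u * v) = 0 then (1 : ℚ) else 0 := by
    rw [← Fintype.sum_prod_type', ← Fintype.sum_prod_type']
    -- The substitution `u = z - y`, `v = z + y`, invertible since `2 ≠ 0`, factors `z² - y²` as `u
    -- v`.
    let e : L × L ≃ L × L :=
      { toFun := fun p => (p.2 - p.1, p.2 + p.1)
        invFun := fun p => ((p.2 - p.1) / 2, (p.2 + p.1) / 2)
        left_inv := fun p => by ext <;> simp <;> field_simp <;> ring
        right_inv := fun p => by ext <;> simp <;> field_simp <;> ring }
    refine Fintype.sum_equiv e _ _ fun p => ?_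
    have : (e p).1 * (e p).2 = p.2 ^ 2 - p.1 ^ 2 := by
      change (p.2 - p.1) * (p.2 + p.1) = _
      ring
    rw [this, map_sub, sub_eq_zero]
  have h4 : ∀ u : L, (Fintype.card K : ℚ) *
      ∑ v : L, (if Algebra.trace K L (u * v) = 0 then (1 : ℚ) else 0) =
      Fintype.card L + if u = 0 then ((Fintype.card K - 1) * Fintype.card L : ℚ) else 0 := by
    intro u
    split_ifs with hu
    · subst hu
      simp
      ring
    · have h5 := card_mul_card_trace_mul_fiber (K := K) hu 0
      rw [Nat.card_eq_fintype_card, Fintype.card_subtype] at h5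
      rw [sum_boole, add_zero]
      exact_mod_cast h5
  rw [h1, h3, mul_sum]
  simp only [h4, sum_add_distrib, sum_ite_eq', sum_const, mem_univ, if_true, card_univ,
    nsmul_eq_mul]
  ring

/-- The value distribution of `t ↦ #{y | Tr(y²) = t}` for odd degree `2j+1`. -/
lemma sum_traceSqCount_odd {q j : ℕ} (hK : Fintype.card K = q) (hq : Odd q)
    (hL : Module.finrank K L = 2 * j + 1) (f : ℤ → ℚ) :
    ∑ t : K, f (traceSqCount K L t) = f (q ^ (2 * j)) +
      (q - 1) / 2 * (f (q ^ (2 * j) + q ^ j) + f (q ^ (2 * j) - q ^ j)) := by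
  classical
  have hK' : Odd (Fintype.card K) := hK ▸ hq
  have hm : Odd (Module.finrank K L) := ⟨j, hL⟩
  have hcardL : Fintype.card L = q ^ (2 * j + 1) := by
    rw [Module.card_eq_pow_finrank (K := K), hL, hK]
  have hq0 : 0 < q := hq.pos
  have hq1 : 1 < q := hK ▸ Fintype.one_lt_card
  obtain ⟨ν, hν⟩ := FiniteField.exists_nonsquare (ringChar_ne_two_of_odd_card hK')
  have hν0 : ν ≠ 0 := by rintro rfl; exact hν (IsSquare.zero)
  -- The deviation from the mean `q^(2j)`: odd under multiplication by `ν`, hence zero at `0`, with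
  -- constant square on `K \ {0}`.
  set δ : K → ℤ := fun t => traceSqCount K L t - q ^ (2 * j) with hδ
  have hM : ∀ t, (traceSqCount K L t : ℤ) = q ^ (2 * j) + δ t := fun t => by simp [hδ]
  have hδν : ∀ t, δ (ν * t) = -δ t := by
    intro t
    have h := traceSqCount_add (L := L) hK' hm hν t
    rw [hcardL, hK] at h
    have h' : traceSqCount K L t + traceSqCount K L (ν * t) = 2 * q ^ (2 * j) := by
      apply Nat.eq_of_mul_eq_mul_left hq0
      rw [h]; ring
    zify at h'
    simp only [hδ]
    linarith
  have hδ0 : δ 0 = 0 := by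
    have := hδν 0
    rw [mul_zero] at this
    linarith
  have hδsq : ∀ t, t ≠ 0 → δ t ^ 2 = δ 1 ^ 2 := by
    intro t ht
    by_cases hs : IsSquare t
    · obtain ⟨a, ha⟩ := hs
      have ha0 : a ≠ 0 := by rintro rfl; simp [ha] at ht
      have := traceSqCount_mul_sq (L := L) (1 : K) ha0
      rw [mul_one, sq, ← ha] at this
      simp only [hδ, this]
    · have hs' : IsSquare (ν⁻¹ * t) := by
        have h1 : quadraticChar K (ν⁻¹ * t) = 1 := by
          have hν' : quadraticChar K ν⁻¹ = -1 :=
            quadraticChar_neg_one_iff_not_isSquare.2 fun h => hν (by simpa using h.inv)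
          rw [map_mul, hν', quadraticChar_neg_one_iff_not_isSquare.2 hs]
          norm_num
        exact (quadraticChar_one_iff_isSquare (mul_ne_zero (inv_ne_zero hν0) ht)).1 h1
      obtain ⟨a, ha⟩ := hs'
      have ha0 : a ≠ 0 := by
        rintro rfl
        simp [hν0, ht] at ha
      have ht' : t = ν * (a ^ 2 * 1) := by
        rw [mul_one, sq, ← ha, mul_inv_cancel_left₀ hν0]
      rw [ht', hδν, neg_sq]
      have := traceSqCount_mul_sq (L := L) (1 : K) ha0
      simp only [hδ, this]
  have hcardK : (Finset.univ.erase (0 : K)).card = q - 1 := by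
    rw [card_erase_of_mem (mem_univ _), card_univ, hK]
  have hsplit : ∀ g : K → ℚ, ∑ t, g t = g 0 + ∑ t ∈ univ.erase 0, g t := fun g =>
    (add_sum_erase univ g (mem_univ 0)).symm
  -- Expanding the second moment around the mean, the linear terms cancel since `δ` sums to zero,
  -- and `(q - 1) δ(1)²` is what remains to be determined.
  have hr : (δ 1) ^ 2 = (q ^ j) ^ 2 := by
    have h := card_mul_sum_traceSqCount_sq (L := L) hK'
    rw [hsplit, sum_congr rfl (g := fun t => (q : ℚ) ^ (4 * j) + δ 1 ^ 2 +
      2 * q ^ (2 * j) * δ t) ?_] at h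
    swap
    · intro t ht
      have h1 : ((traceSqCount K L t : ℤ) : ℚ) = q ^ (2 * j) + δ t := by
        rw [hM]; push_cast; ring
      have h2 : ((δ t : ℤ) : ℚ) ^ 2 = (δ 1 : ℚ) ^ 2 := by
        exact_mod_cast hδsq t (ne_of_mem_erase ht)
      have h1' : (traceSqCount K L t : ℚ) = q ^ (2 * j) + δ t := by exact_mod_cast h1
      rw [h1']
      linear_combination h2
    have hsum0 : ∑ t ∈ univ.erase 0, (δ t : ℚ) = 0 := by
      have h5 : ∑ t : K, (δ t : ℚ) = ∑ t : K, -(δ t : ℚ) :=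
        Fintype.sum_equiv (Equiv.mulLeft₀ ν⁻¹ (inv_ne_zero hν0)) _ _ fun t => by
          have h6 := hδν (ν⁻¹ * t)
          rw [mul_inv_cancel_left₀ hν0] at h6
          simp [h6]
      rw [sum_neg_distrib, hsplit, hδ0] at h5
      push_cast at h5
      linarith
    have h0 : (traceSqCount K L (0 : K) : ℚ) = q ^ (2 * j) := by
      have := hM 0
      rw [hδ0, add_zero] at this
      exact_mod_cast this
    rw [sum_add_distrib, ← mul_sum, hsum0, sum_const, hcardK, h0, hK, hcardL, nsmul_eq_mul,
      Nat.cast_sub hq1.le] at h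
    push_cast at h
    have hq' : (q : ℚ) * (q - 1) ≠ 0 := by
      have : (1 : ℚ) < q := by exact_mod_cast hq1
      exact mul_ne_zero (by linarith) (by linarith)
    have h7 : (δ 1 : ℚ) ^ 2 = (q ^ j) ^ 2 := by
      apply mul_left_cancel₀ hq'
      linear_combination h
    exact_mod_cast h7
  have hpair : ∀ t, t ≠ 0 → f (q ^ (2 * j) + δ t) + f (q ^ (2 * j) - δ t) =
      f (q ^ (2 * j) + q ^ j) + f (q ^ (2 * j) - q ^ j) := by
    intro t ht
    rcases sq_eq_sq_iff_eq_or_eq_neg.1 ((hδsq t ht).trans hr) with h | h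
    · rw [h]
    · rw [h, sub_neg_eq_add, ← sub_eq_add_neg, add_comm]
  -- The sign of `δ 1` is never determined: averaging over `t` and `ν t` makes both signs appear
  -- equally often.
  have hdouble : ∑ t : K, f (traceSqCount K L t) = ∑ t : K, f (q ^ (2 * j) - δ t) := by
    refine Fintype.sum_equiv (Equiv.mulLeft₀ ν⁻¹ (inv_ne_zero hν0)) _ _ fun t => ?_
    have h6 := hδν (ν⁻¹ * t)
    rw [mul_inv_cancel_left₀ hν0] at h6
    simp [hM, h6, sub_eq_add_neg]
  have hfin : 2 * ∑ t : K, f (traceSqCount K L t) = 2 * f (q ^ (2 * j)) +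
      (q - 1) * (f (q ^ (2 * j) + q ^ j) + f (q ^ (2 * j) - q ^ j)) := by
    rw [two_mul]
    nth_rw 2 [hdouble]
    simp only [hM]
    rw [← sum_add_distrib, hsplit, sum_congr rfl fun t ht => hpair t (ne_of_mem_erase ht),
      sum_const, hcardK, hδ0, nsmul_eq_mul, Nat.cast_sub hq1.le]
    push_cast
    simp only [add_zero, sub_zero]
    ring
  linarith

end OddDegree

/-! ### Values of `Tr(y²)` for odd `q` and even degree, through a quadratic extension `L/E`. -/

section EvenDegree

lemma card_pow_eq_of_exists {R : Type*} [CommRing R] [IsDomain R] {ζ : R} {n : ℕ} (hn : 0 < n)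
    (hζ : IsPrimitiveRoot ζ n) {a : R} (ha : a ≠ 0) (hex : ∃ α, α ^ n = a) :
    Nat.card {y : R // y ^ n = a} = n := by
  classical
  have h := hζ.card_nthRoots a
  rw [if_pos hex, ← Multiset.toFinset_card_of_nodup (hζ.nthRoots_nodup ha)] at h
  refine Eq.trans ?_ h
  rw [← Nat.card_eq_finsetCard]
  exact Nat.card_congr (Equiv.subtypeEquivRight fun y => by
    rw [Multiset.mem_toFinset, Polynomial.mem_nthRoots hn])

variable {E L : Type*} [Field E] [Fintype E] [Field L] [Fintype L] [Algebra E L]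

/-- In a quadratic extension the trace is `z + z^Q`, so `Tr(y²) = y² (1 + y^(2(Q-1)))`. -/
lemma trace_sq_eq_zero_iff {Q : ℕ} (hE : Fintype.card E = Q) (hL : Module.finrank E L = 2)
    (y : L) : Algebra.trace E L (y ^ 2) = 0 ↔ y = 0 ∨ y ^ (2 * (Q - 1)) = -1 := by
  have hQ : 1 ≤ Q := hE ▸ Fintype.card_pos
  have h1 : algebraMap E L (Algebra.trace E L (y ^ 2)) = y ^ 2 * (1 + y ^ (2 * (Q - 1))) := by
    rw [FiniteField.algebraMap_trace_eq_sum_pow, hL, Nat.card_eq_fintype_card, hE,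
      sum_range_succ, sum_range_one, pow_zero, pow_one, pow_one, mul_add, mul_one, ← pow_mul,
      ← pow_add]
    congr 2
    omega
  rw [← map_eq_zero (algebraMap E L), h1, mul_eq_zero, pow_eq_zero_iff two_ne_zero, add_comm,
    add_eq_zero_iff_eq_neg]

lemma traceSqCount_zero_of_card_mod_four_eq_one {Q : ℕ} (hE : Fintype.card E = Q)
    (hL : Module.finrank E L = 2) (hQ : Q % 4 = 1) : traceSqCount E L 0 = 1 := by
  have hcardL : Fintype.card L = Q ^ 2 := by
    rw [Module.card_eq_pow_finrank (K := E), hL, hE]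
  have hL2 : (2 : L) ≠ 0 := two_ne_zero_of_odd_card (by
    rw [hcardL]; exact (Nat.odd_iff.2 (by omega)).pow)
  have huniq : ∀ y : L, Algebra.trace E L (y ^ 2) = 0 → y = 0 := by
    intro y hy
    rcases (trace_sq_eq_zero_iff hE hL y).1 hy with h | h
    · exact h
    · by_contra hy0
      obtain ⟨k, rfl⟩ : ∃ k, Q = 4 * k + 1 := ⟨Q / 4, by omega⟩
      have h1 := FiniteField.pow_card_sub_one_eq_one y hy0
      rw [hcardL] at h1
      -- Here `(Q² - 1) / (2(Q - 1)) = (Q + 1) / 2 = 2k + 1` is odd, so `y^(2(Q-1)) = -1` would give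
      -- `y^(Q²-1) = -1`, against `y^(Q²-1) = 1`.
      have h2 : (4 * k + 1) ^ 2 - 1 = (2 * (4 * k + 1 - 1)) * (2 * k + 1) := by
        rw [Nat.add_sub_cancel]
        apply Nat.sub_eq_of_eq_add
        ring
      rw [h2, pow_mul, h, Odd.neg_one_pow ⟨k, rfl⟩] at h1
      exact hL2 (by linear_combination -h1)
  rw [traceSqCount, Nat.card_eq_one_iff_unique]
  exact ⟨⟨fun a b => Subtype.ext ((huniq _ a.2).trans (huniq _ b.2).symm)⟩, ⟨⟨0, by simp⟩⟩⟩

lemma traceSqCount_zero_of_card_mod_four_eq_three {Q : ℕ} (hE : Fintype.card E = Q)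
    (hL : Module.finrank E L = 2) (hQ : Q % 4 = 3) :
    traceSqCount E L 0 = 1 + 2 * (Q - 1) := by
  classical
  have hcardL : Fintype.card L = Q ^ 2 := by
    rw [Module.card_eq_pow_finrank (K := E), hL, hE]
  have hLodd : Odd (Fintype.card L) := by
    rw [hcardL]; exact (Nat.odd_iff.2 (by omega)).pow
  obtain ⟨k, rfl⟩ : ∃ k, Q = 4 * k + 3 := ⟨Q / 4, by omega⟩
  obtain ⟨g, hg⟩ := IsCyclic.exists_ofOrder_eq_natCard (α := Lˣ)
  -- Now `(Q + 1) / 2 = 2(k + 1)` is even. With `n = 2(Q - 1)`, the power `g^(2(k+1))` is a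
  -- primitive `n`-th root of unity and `g^(k+1)` is an `n`-th root of `-1`, so there are exactly
  -- `n` such roots.
  have hord : orderOf (g : L) = (2 * (4 * k + 3 - 1)) * (2 * (k + 1)) := by
    rw [orderOf_units, hg, Nat.card_units, Nat.card_eq_fintype_card, hcardL]
    apply Nat.sub_eq_of_eq_add
    have : 4 * k + 3 - 1 = 4 * k + 2 := by omega
    rw [this]
    ring
  set n := 2 * (4 * k + 3 - 1) with hn
  have hn0 : 0 < n := by omega
  have hprim : IsPrimitiveRoot ((g : L) ^ (2 * (k + 1))) n :=
    (IsPrimitiveRoot.orderOf (g : L)).pow (by rw [hord]; positivity) (by rw [hord]; ring)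
  have hhalf : ((g : L) ^ (k + 1)) ^ n = -1 := by
    have h1 : (((g : L) ^ (k + 1)) ^ n) ^ 2 = 1 := by
      rw [← pow_mul, ← pow_mul, show (k + 1) * (n * 2) = n * (2 * (k + 1)) by ring, ← hord,
        pow_orderOf_eq_one]
    refine (sq_eq_sq_iff_eq_or_eq_neg.1 (h1.trans (one_pow 2).symm)).resolve_left fun h2 => ?_
    rw [← pow_mul] at h2
    have h3 := orderOf_dvd_of_pow_eq_one h2
    rw [hord] at h3
    have h4 := Nat.le_of_dvd (by positivity) h3
    nlinarith
  have hcard : Nat.card {y : L // y ^ n = -1} = n :=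
    card_pow_eq_of_exists hn0 hprim (neg_ne_zero.2 one_ne_zero) ⟨_, hhalf⟩
  rw [traceSqCount, ← hcard, Nat.card_eq_fintype_card, Nat.card_eq_fintype_card,
    Fintype.card_subtype, Fintype.card_subtype]
  have : (univ.filter fun y : L => Algebra.trace E L (y ^ 2) = 0) =
      insert 0 (univ.filter fun y : L => y ^ n = -1) := by
    ext y
    simp [trace_sq_eq_zero_iff hE hL, hn]
  rw [this, card_insert_of_notMem, add_comm]
  simp [zero_pow hn0.ne']

/-- Elements of the base field become squares in a quadratic extension. -/
lemma isSquare_algebraMap_of_finrank_two (hE : Odd (Fintype.card E))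
    (hL : Module.finrank E L = 2) (s : E) : IsSquare (algebraMap E L s) := by
  by_cases hs : s = 0
  · simp [hs]
  have hcardL : Fintype.card L = Fintype.card E ^ 2 := by
    rw [Module.card_eq_pow_finrank (K := E), hL]
  have hLodd : Odd (Fintype.card L) := by
    rw [hcardL]; exact hE.pow
  rw [FiniteField.isSquare_iff (ringChar_ne_two_of_odd_card hLodd) (by simpa using hs)]
  obtain ⟨k, hk⟩ := hE
  -- For Euler's criterion: the exponent `(Q² - 1) / 2`, with `Q = |E|`, is a multiple of `Q - 1`,
  -- the order of the group of units of `E`.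
  have h2 : Fintype.card L / 2 = (2 * k) * (k + 1) := by
    rw [hcardL, hk]
    have : (2 * k + 1) ^ 2 = 2 * (2 * k * (k + 1)) + 1 := by ring
    omega
  have h3 := FiniteField.pow_card_sub_one_eq_one s hs
  rw [hk, Nat.add_sub_cancel] at h3
  rw [h2, ← map_pow, pow_mul, h3, one_pow, map_one]

lemma traceSqCount_of_ne_zero (hE : Odd (Fintype.card E))
    (hL : Module.finrank E L = 2) {s : E} (hs : s ≠ 0) :
    traceSqCount E L s = traceSqCount E L 1 := by
  obtain ⟨a, ha⟩ := isSquare_algebraMap_of_finrank_two (L := L) hE hL s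
  have ha0 : a ≠ 0 := by rintro rfl; simp [hs] at ha
  refine (Nat.card_congr ((Equiv.mulLeft₀ a ha0).subtypeEquiv fun y => ?_)).symm
  have : (Equiv.mulLeft₀ a ha0 y) ^ 2 = s • y ^ 2 := by
    rw [Algebra.smul_def, ha, Equiv.mulLeft₀_apply]
    ring
  rw [this, map_smul, smul_eq_mul, mul_eq_left₀ hs]

/-- The sign `(-1)^((Q-1)/2)` merges the two residues of `Q` modulo `4`. The count at zero is known,
the others are all equal, and the total is `Q²`. -/
lemma traceSqCount_quadratic {Q : ℕ} (hE : Fintype.card E = Q) (hQ : Odd Q)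
    (hL : Module.finrank E L = 2) (s : E) [Decidable (s = 0)] :
    (traceSqCount E L s : ℤ) =
      Q + (-1) ^ ((Q - 1) / 2) - if s = 0 then (-1) ^ ((Q - 1) / 2) * (Q : ℤ) else 0 := by
  classical
  have hE' : Odd (Fintype.card E) := hE ▸ hQ
  have hQ1 : 1 < Q := hE ▸ Fintype.one_lt_card
  have h0 : (traceSqCount E L 0 : ℤ) = Q - (-1) ^ ((Q - 1) / 2) * (Q - 1) := by
    rcases Nat.odd_mod_four_iff.1 (Nat.odd_iff.1 hQ) with h | h
    · rw [traceSqCount_zero_of_card_mod_four_eq_one hE hL h,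
        Even.neg_one_pow (Nat.even_iff.2 (by omega))]
      push_cast
      ring
    · rw [traceSqCount_zero_of_card_mod_four_eq_three hE hL h,
        Odd.neg_one_pow (Nat.odd_iff.2 (by omega)), Nat.cast_add, Nat.cast_mul,
        Nat.cast_sub hQ1.le]
      push_cast
      ring
  split_ifs with hs
  · rw [hs, h0]; ring
  · rw [traceSqCount_of_ne_zero hE' hL hs]
    have hsum := sum_traceSq (K := E) (L := L) fun _ => 1
    have hcongr : ∑ t ∈ univ.erase (0 : E), (traceSqCount E L t : ℚ) * 1 =
        ∑ t ∈ univ.erase (0 : E), (traceSqCount E L (1 : E) : ℚ) :=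
      sum_congr rfl fun t ht => by
        rw [mul_one, traceSqCount_of_ne_zero hE' hL (ne_of_mem_erase ht)]
    rw [← add_sum_erase univ _ (mem_univ (0 : E)), hcongr, sum_const, sum_const,
      card_erase_of_mem (mem_univ _), card_univ, card_univ,
      Module.card_eq_pow_finrank (K := E) (V := L), hE, hL, nsmul_eq_mul, nsmul_eq_mul,
      Nat.cast_sub hQ1.le] at hsum
    push_cast at hsum
    have h0' : (traceSqCount E L (0 : E) : ℚ) = Q - (-1) ^ ((Q - 1) / 2) * (Q - 1) := by
      exact_mod_cast h0
    have hQ' : (Q : ℚ) - 1 ≠ 0 := by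
      have : (1 : ℚ) < Q := by exact_mod_cast hQ1
      linarith
    have h1 : (traceSqCount E L (1 : E) : ℚ) = Q + (-1) ^ ((Q - 1) / 2) := by
      apply mul_left_cancel₀ hQ'
      linear_combination -hsum - h0'
    rw [sub_zero]
    exact_mod_cast h1

/-- A finite field of even degree over `K` is a quadratic extension of an intermediate field. -/
lemma exists_intermediateField_finrank_two {K L : Type*} [Field K] [Finite K] [Field L] [Finite L]
    [Algebra K L] (hm : Even (Module.finrank K L)) :
    ∃ F : IntermediateField K L, Module.finrank F L = 2 := by
  -- By Cauchy's theorem the Galois group, of even order, contains an involution; its fixed field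
  -- has index two.
  have h2 : 2 ∣ Nat.card (L ≃ₐ[K] L) := by
    rw [IsGalois.card_aut_eq_finrank]
    exact hm.two_dvd
  obtain ⟨τ, hτ⟩ := exists_prime_orderOf_dvd_card' 2 h2
  refine ⟨IntermediateField.fixedField (Subgroup.zpowers τ), ?_⟩
  rw [IntermediateField.finrank_fixedField_eq_card, Nat.card_zpowers, hτ]

/-- By transitivity of the trace, the counts over `F` are summed along the fibre of `Tr_{F/K}` over
`t`. They are constant except at `s = 0`, which lies in that fibre only if `t = 0`. -/
lemma traceSqCount_even {K : Type*} [Field K] [Fintype K] [Algebra K L] {q k : ℕ}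
    (hK : Fintype.card K = q) (hq : Odd q) (hk : 0 < k)
    (hL : Module.finrank K L = 2 * k) (t : K) [Decidable (t = 0)] :
    (traceSqCount K L t : ℤ) =
      q ^ (2 * k - 1) + (-1) ^ ((q ^ k - 1) / 2) * q ^ (k - 1) -
        if t = 0 then (-1) ^ ((q ^ k - 1) / 2) * (q : ℤ) ^ k else 0 := by
  classical
  obtain ⟨F, hF⟩ := exists_intermediateField_finrank_two (K := K) (L := L) (hL ▸ even_two_mul k)
  have : Fintype F := Fintype.ofFinite F
  have hKF : Module.finrank K F = k := by
    have := Module.finrank_mul_finrank K F L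
    rw [hF, hL] at this
    omega
  have hcardF : Fintype.card F = q ^ k := by
    rw [Module.card_eq_pow_finrank (K := K), hKF, hK]
  have hq0 : (q : ℚ) ≠ 0 := by exact_mod_cast hq.pos.ne'
  obtain ⟨j, rfl⟩ : ∃ j, k = j + 1 := ⟨k - 1, by omega⟩
  set e : ℤ := (-1) ^ ((q ^ (j + 1) - 1) / 2) with he
  have h1 : (traceSqCount K L t : ℚ) = ∑ y : L,
      if Algebra.trace K F (Algebra.trace F L (y ^ 2)) = t then 1 else 0 := by
    rw [sum_boole, ← Fintype.card_subtype, ← Nat.card_eq_fintype_card, traceSqCount]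
    congr 1
    exact Nat.card_congr (Equiv.subtypeEquivRight fun y => by rw [Algebra.trace_trace])
  rw [sum_traceSq (K := F) fun s => if Algebra.trace K F s = t then (1 : ℚ) else 0] at h1
  have h2 : ∀ s : F, (traceSqCount F L s : ℚ) = q ^ (j + 1) + e -
      if s = 0 then (e : ℚ) * q ^ (j + 1) else 0 := by
    intro s
    have := traceSqCount_quadratic (L := L) hcardF hq.pow hF s
    rw [← he] at this
    split_ifs at this ⊢ <;> push_cast at this <;> exact_mod_cast this
  have h3 := card_mul_sum_trace K F fun s => if s = t then (1 : ℚ) else 0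
  rw [sum_ite_eq' univ t, if_pos (mem_univ _), mul_one, hK, hcardF] at h3
  simp only [h2, sub_mul, sum_sub_distrib, ← mul_sum, ite_mul, zero_mul, sum_ite_eq',
    mem_univ, if_true, map_zero] at h1
  have h4 : ∑ x : F, (if Algebra.trace K F x = t then (1 : ℚ) else 0) = q ^ j := by
    apply mul_left_cancel₀ hq0
    rw [h3]
    push_cast
    ring
  rw [h4] at h1
  have h5 : (2 * (j + 1) - 1) = (j + 1) + j := by omega
  rw [h5, Nat.add_sub_cancel]
  have h6 : (traceSqCount K L t : ℚ) = q ^ (j + 1 + j) + e * q ^ j -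
      if t = 0 then (e : ℚ) * q ^ (j + 1) else 0 := by
    rw [h1]
    by_cases ht : t = 0
    · simp [ht]; ring
    · rw [if_neg ht, if_neg (Ne.symm ht)]; ring
  split_ifs at h6 ⊢ <;> exact_mod_cast h6

end EvenDegree

/-! ### Distribution of the number of zeros of `Tr(y² + c y + a)`. -/

section ZeroCount

variable {K L : Type*} [Field K] [Field L] [Algebra K L]

variable (K) in
/-- The number of `y ∈ L` with `Tr(y² + c y + a) = 0`. -/
noncomputable def zeroCount (a c : L) : ℕ :=
  Nat.card {y : L // Algebra.trace K L (y ^ 2 + c * y + a) = 0}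

lemma zeroCount_eq_traceSqCount (h2 : (2 : L) ≠ 0) (a c : L) :
    zeroCount K a c = traceSqCount K L (Algebra.trace K L (c ^ 2 / 4 - a)) := by
  have h4 : (4 : L) ≠ 0 := by
    rw [show (4 : L) = 2 * 2 by norm_num]
    exact mul_ne_zero h2 h2
  refine Nat.card_congr ((Equiv.addRight (c / 2)).subtypeEquiv fun y => ?_)
  rw [← sub_eq_zero (a := Algebra.trace K L _) (b := Algebra.trace K L (c ^ 2 / 4 - a)),
    ← map_sub, Equiv.coe_addRight]
  have : (y + c / 2) ^ 2 - (c ^ 2 / 4 - a) = y ^ 2 + c * y + a := by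
    rw [show (4 : L) = 2 * 2 by norm_num] at *
    field_simp
    ring
  rw [this]

variable [Fintype K] [Fintype L]

/-- After completing the square, for each fixed `c` the argument `c²/4 - a` runs once over `L`, so
its trace takes each value `q^d` times. -/
lemma sum_zeroCount_of_odd {q d : ℕ} (hK : Fintype.card K = q) (hq : Odd q)
    (hL : Module.finrank K L = d + 1) (f : ℤ → ℚ) :
    ∑ c : L, ∑ a : L, f (zeroCount K a c) =
      q ^ (d + 1) * q ^ d * ∑ t : K, f (traceSqCount K L t) := by
  have hcardL : Fintype.card L = q ^ (d + 1) := by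
    rw [Module.card_eq_pow_finrank (K := K), hL, hK]
  have h2 : (2 : L) ≠ 0 := two_ne_zero_of_odd_card (by rw [hcardL]; exact hq.pow)
  have hq0 : (q : ℚ) ≠ 0 := by exact_mod_cast hq.pos.ne'
  have h1 : ∀ c : L, ∑ a : L, f (zeroCount K a c) =
      q ^ d * ∑ t : K, f (traceSqCount K L t) := by
    intro c
    have h3 := card_mul_sum_trace K L fun t => f (traceSqCount K L t)
    rw [hK, hcardL] at h3
    apply mul_left_cancel₀ hq0
    have h4 : ∑ a : L, f (zeroCount K a c) =
        ∑ x : L, f (traceSqCount K L (Algebra.trace K L x)) :=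
      Fintype.sum_equiv (Equiv.subLeft (c ^ 2 / 4)) _ _ fun a => by
        rw [zeroCount_eq_traceSqCount h2, Equiv.subLeft_apply]
    rw [h4, h3]
    push_cast
    ring
  simp only [h1, sum_const, card_univ, hcardL, nsmul_eq_mul]
  push_cast
  ring

lemma trace_sq_of_charP_two {K L : Type*} [Field K] [Field L] [Finite L] [Algebra K L] [CharP L 2] (y : L) :
    Algebra.trace K L (y ^ 2) = Algebra.trace K L y ^ 2 := by
  apply (algebraMap K L).injective
  rw [map_pow (algebraMap K L), FiniteField.algebraMap_trace_eq_sum_pow, FiniteField.algebraMap_trace_eq_sum_pow,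
    CharTwo.sum_sq]
  exact sum_congr rfl fun i _ => by rw [← pow_mul, ← pow_mul, mul_comm]

lemma charP_two_of_even_card {F : Type*} [Field F] [Fintype F] (h : Even (Fintype.card F)) :
    CharP F 2 :=
  ringChar.of_eq (FiniteField.even_card_iff_char_two.2 (Nat.even_iff.1 h))

/-- In characteristic two, `t² + k t` (`k ≠ 0`) takes half of the values, each of them twice. -/
lemma sum_card_quadratic_fiber {F : Type*} [Field F] [Fintype F] [CharP F 2] {k : F} (hk : k ≠ 0)
    (f : ℕ → ℚ) :
    ∑ α : F, f (Nat.card {t : F // t ^ 2 + k * t = α}) =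
      Fintype.card F / 2 * (f 0 + f 2) := by
  classical
  have h1 : ∀ α : F, Nat.card {t : F // t ^ 2 + k * t = α} = 0 ∨
      Nat.card {t : F // t ^ 2 + k * t = α} = 2 := by
    intro α
    by_cases h : ∃ t0 : F, t0 ^ 2 + k * t0 = α
    · right
      obtain ⟨t0, rfl⟩ := h
      rw [Nat.card_eq_fintype_card, Fintype.card_subtype]
      have : (univ.filter fun t => t ^ 2 + k * t = t0 ^ 2 + k * t0) = {t0, t0 + k} := by
        ext t
        simp only [mem_filter, mem_univ, true_and, mem_insert, mem_singleton]
        have h2 : t ^ 2 + k * t = t0 ^ 2 + k * t0 ↔ (t - t0) * (t - (t0 + k)) = 0 := by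
          rw [← sub_eq_zero]
          have h3 : (2 : F) = 0 := CharTwo.two_eq_zero
          have : (t - t0) * (t - (t0 + k)) = t ^ 2 + k * t - (t0 ^ 2 + k * t0) := by
            linear_combination (t0 ^ 2 - t * t0 - k * t + k * t0) * h3
          rw [this]
        rw [h2, mul_eq_zero, sub_eq_zero, sub_eq_zero]
      rw [this, card_pair]
      simpa using hk
    · left
      rw [Nat.card_eq_zero]
      left
      exact ⟨fun t => h ⟨t.1, t.2⟩⟩
  -- On the two possible values `0` and `2`, `f` agrees with an affine function of the fibre size,
  -- and the fibre sizes sum to `|F|`.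
  have h2 : ∀ α : F, f (Nat.card {t : F // t ^ 2 + k * t = α}) =
      f 0 + (Nat.card {t : F // t ^ 2 + k * t = α} : ℚ) * ((f 2 - f 0) / 2) := by
    intro α
    rcases h1 α with h | h <;> rw [h]
    · simp
    · push_cast; ring
  have h3 := sum_comp_eq_sum_card_mul (fun t : F => t ^ 2 + k * t) fun _ => ((f 2 - f 0) / 2)
  simp only [h2, sum_add_distrib, ← h3, sum_const, card_univ, nsmul_eq_mul]
  ring

/-- With `(s, t) = (Tr y, Tr(c y))` equidistributed on `K²`, the condition `s² + t + Tr a = 0`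
determines `t` from `s`. -/
lemma zeroCount_of_notMem_range [CharP L 2] {q d : ℕ} (hK : Fintype.card K = q)
    (hL : Module.finrank K L = d + 1) (a : L) {c : L} (hc : c ∉ Set.range (algebraMap K L)) :
    zeroCount K a c = q ^ d := by
  classical
  have hcardL : Fintype.card L = q ^ (d + 1) := by
    rw [Module.card_eq_pow_finrank (K := K), hL, hK]
  have hq0 : (q : ℚ) ≠ 0 := by exact_mod_cast hK ▸ Fintype.card_ne_zero
  let φ : L →+ K × K := ((Algebra.trace K L).prod
    ((Algebra.trace K L).comp (LinearMap.mulLeft K c))).toAddMonoidHom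
  have h := card_mul_sum_comp φ (trace_pair_surjective hc)
    fun p => if p.1 ^ 2 + p.2 + Algebra.trace K L a = 0 then 1 else 0
  have h1 : ∀ y, (φ y).1 ^ 2 + (φ y).2 + Algebra.trace K L a =
      Algebra.trace K L (y ^ 2 + c * y + a) := by
    intro y
    rw [map_add, map_add, trace_sq_of_charP_two]
    rfl
  have h2 : ∀ s : K, ∑ t : K,
      (if s ^ 2 + t + Algebra.trace K L a = 0 then (1 : ℚ) else 0) = 1 := by
    intro s
    have h3 : ∀ t : K, s ^ 2 + t + Algebra.trace K L a = 0 ↔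
        t = -(s ^ 2 + Algebra.trace K L a) := fun t =>
      ⟨fun h => by linear_combination h, fun h => by linear_combination h⟩
    simp only [h3, sum_ite_eq', mem_univ, if_true]
  rw [Fintype.sum_prod_type] at h
  simp only [h2] at h
  simp only [h1, sum_const, card_univ, Fintype.card_prod, hK, hcardL, sum_boole, nsmul_eq_mul,
    mul_one] at h
  rw [← Fintype.card_subtype, ← Nat.card_eq_fintype_card] at h
  have h4 : (zeroCount K a c : ℚ) = q ^ d := by
    apply mul_left_cancel₀ (mul_ne_zero hq0 hq0)
    rw [zeroCount]
    push_cast at h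
    rw [h]
    ring
  exact_mod_cast h4

/-- For `c = k ∈ K` the condition involves `y` only through `Tr y`, whose fibres have `q^d`
elements. -/
lemma zeroCount_algebraMap [CharP L 2] {q d : ℕ} (hK : Fintype.card K = q)
    (hL : Module.finrank K L = d + 1) (a : L) (k : K) :
    zeroCount K a (algebraMap K L k) =
      q ^ d * Nat.card {t : K // t ^ 2 + k * t = -Algebra.trace K L a} := by
  classical
  have hcardL : Fintype.card L = q ^ (d + 1) := by
    rw [Module.card_eq_pow_finrank (K := K), hL, hK]
  have hq0 : (q : ℚ) ≠ 0 := by exact_mod_cast hK ▸ Fintype.card_ne_zero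
  have h := card_mul_sum_trace K L
    fun t => if t ^ 2 + k * t = -Algebra.trace K L a then 1 else 0
  have h1 : ∀ y, Algebra.trace K L y ^ 2 + k * Algebra.trace K L y = -Algebra.trace K L a ↔
      Algebra.trace K L (y ^ 2 + algebraMap K L k * y + a) = 0 := by
    intro y
    rw [map_add, map_add, trace_sq_of_charP_two, ← Algebra.smul_def, map_smul, smul_eq_mul,
      add_eq_zero_iff_eq_neg]
  simp only [h1, hK, hcardL, sum_boole] at h
  rw [← Fintype.card_subtype, ← Fintype.card_subtype, ← Nat.card_eq_fintype_card,
    ← Nat.card_eq_fintype_card] at h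
  have h4 : (zeroCount K a (algebraMap K L k) : ℚ) =
      q ^ d * Nat.card {t : K // t ^ 2 + k * t = -Algebra.trace K L a} := by
    apply mul_left_cancel₀ hq0
    rw [zeroCount, h]
    push_cast
    ring
  exact_mod_cast h4

lemma zeroCount_zero_right [CharP L 2] [CharP K 2] {q d : ℕ} (hK : Fintype.card K = q)
    (hL : Module.finrank K L = d + 1) (a : L) :
    zeroCount K a 0 = q ^ d := by
  have h := zeroCount_algebraMap hK hL a (0 : K)
  rw [map_zero] at h
  have h1 : Nat.card {t : K // t ^ 2 + 0 * t = -Algebra.trace K L a} = 1 := by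
    have hbij : Function.Bijective (fun t : K => t ^ 2 + 0 * t) := by
      rw [← Finite.injective_iff_bijective]
      intro s t hst
      simp only [zero_mul, add_zero] at hst
      exact CharTwo.sq_injective hst
    obtain ⟨t, ht, huniq⟩ := hbij.existsUnique (-Algebra.trace K L a)
    rw [Nat.card_eq_one_iff_unique]
    exact ⟨⟨fun x y => Subtype.ext ((huniq _ x.2).trans (huniq _ y.2).symm)⟩, ⟨⟨t, ht⟩⟩⟩
  rw [h, h1, mul_one]

lemma sum_zeroCount_of_even {q d : ℕ} (hK : Fintype.card K = q) (hq : Even q)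
    (hL : Module.finrank K L = d + 1) (f : ℤ → ℚ) :
    ∑ c : L, ∑ a : L, f (zeroCount K a c) =
      q ^ (d + 1) * (q ^ (d + 1) - q + 1) * f (q ^ d) +
        q ^ (d + 1) / 2 * (q - 1) * (f 0 + f (2 * q ^ d)) := by
  classical
  have hcardL : Fintype.card L = q ^ (d + 1) := by
    rw [Module.card_eq_pow_finrank (K := K), hL, hK]
  have hqpos : 1 ≤ q := hK ▸ Fintype.card_pos
  have hq0 : (q : ℚ) ≠ 0 := by exact_mod_cast hK ▸ Fintype.card_ne_zero
  have : CharP K 2 := charP_two_of_even_card (hK ▸ hq)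
  have : CharP L 2 := charP_two_of_even_card (by
    rw [hcardL]; exact (Nat.even_pow' (by omega)).2 hq)
  have hbase : ∀ k : K, k ≠ 0 → ∑ a : L, f (zeroCount K a (algebraMap K L k)) =
      q ^ (d + 1) / 2 * (f 0 + f (2 * q ^ d)) := by
    intro k hk
    simp only [zeroCount_algebraMap hK hL]
    have h1 := card_mul_sum_trace K L fun α =>
      f ((q ^ d * Nat.card {t : K // t ^ 2 + k * t = -α} : ℕ))
    have h2 : ∑ α : K, f ((q ^ d * Nat.card {t : K // t ^ 2 + k * t = -α} : ℕ)) =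
        ∑ α : K, f ((q ^ d * Nat.card {t : K // t ^ 2 + k * t = α} : ℕ)) :=
      Fintype.sum_equiv (Equiv.neg K) _ _ fun α => rfl
    rw [h2, sum_card_quadratic_fiber hk fun n => f ((q ^ d * n : ℕ)), hK, hcardL] at h1
    apply mul_left_cancel₀ hq0
    rw [h1, Nat.mul_zero, Nat.mul_comm (q ^ d) 2]
    push_cast
    ring
  have hrest : ∀ c : L, c ∉ (univ.erase (0 : K)).image (algebraMap K L) →
      ∑ a : L, f (zeroCount K a c) = q ^ (d + 1) * f (q ^ d) := by
    intro c hc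
    have h1 : ∀ a, zeroCount K a c = q ^ d := by
      intro a
      by_cases hr : c ∈ Set.range (algebraMap K L)
      · obtain ⟨k, rfl⟩ := hr
        have hk : k = 0 := by
          by_contra hk
          exact hc (mem_image_of_mem _ (mem_erase.2 ⟨hk, mem_univ _⟩))
        rw [hk, map_zero, zeroCount_zero_right hK hL]
      · exact zeroCount_of_notMem_range hK hL a hr
    simp only [h1, sum_const, card_univ, hcardL, nsmul_eq_mul]
    push_cast
    rfl
  have hcardI : ((univ.erase (0 : K)).image (algebraMap K L)).card = q - 1 := by
    rw [card_image_of_injective _ (algebraMap K L).injective, card_erase_of_mem (mem_univ _),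
      card_univ, hK]
  rw [← sum_add_sum_compl ((univ.erase (0 : K)).image (algebraMap K L)),
    sum_congr rfl (g := fun _ => (q : ℚ) ^ (d + 1) / 2 * (f 0 + f (2 * q ^ d))) ?_,
    sum_congr (s₁ := ((univ.erase (0 : K)).image (algebraMap K L))ᶜ) rfl
      fun c hc => hrest c (mem_compl.1 hc)]
  · have hle : q - 1 ≤ q ^ (d + 1) :=
      (Nat.sub_le _ _).trans (Nat.le_self_pow (by omega) q)
    rw [sum_const, sum_const, card_compl, hcardI, hcardL, nsmul_eq_mul, nsmul_eq_mul,
      Nat.cast_sub hle, Nat.cast_sub hqpos]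
    push_cast
    ring
  · intro c hc
    obtain ⟨k, hk, rfl⟩ := mem_image.1 hc
    exact hbase k (ne_of_mem_erase hk)

end ZeroCount

/-! ### Weights of codewords as point counts on lines. -/

section Weights

variable {K L : Type*} [Field K] [Field L] [Algebra K L]

lemma vecMul_genMatrix_none {f g : L → L} (u : Fin 3 → L) :
    (genMatrix f g).vecMulLinear u none = u 1 := by
  simp [genMatrix, Matrix.vecMul, dotProduct, Fin.sum_univ_three]

lemma vecMul_genMatrix_some {f g : L → L} (u : Fin 3 → L) (p : {p : L × L // f p.1 + g p.2 = 0}) :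
    (genMatrix f g).vecMulLinear u (some p) = u 0 + u 1 * p.1.1 + u 2 * p.1.2 := by
  simp [genMatrix, Matrix.vecMul, dotProduct, Fin.sum_univ_three]

lemma trace_add_traceSq_eq_zero_iff (x y : L) :
    traceFun K L x + traceSqFun K L y = 0 ↔ Algebra.trace K L (x + y ^ 2) = 0 := by
  rw [traceFun, traceSqFun, ← map_add, map_eq_zero, map_add]

variable (K L) in
/-- The points `(x, y)` with `Tr(x) + Tr(y²) = 0`. -/
abbrev Points : Type _ := {p : L × L // traceFun K L p.1 + traceSqFun K L p.2 = 0}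

variable (K L) in
/-- Substituting `x + y²` for `x` turns the points into a product. -/
def pointsEquiv : Points K L ≃ {x : L // Algebra.trace K L x = 0} × L where
  toFun p := (⟨p.1.1 + p.1.2 ^ 2, (trace_add_traceSq_eq_zero_iff _ _).1 p.2⟩, p.1.2)
  invFun r := ⟨(r.1 - r.2 ^ 2, r.2), (trace_add_traceSq_eq_zero_iff _ _).2 (by simp [r.1.2])⟩
  left_inv p := by simp
  right_inv r := by simp

lemma exists_point [FiniteDimensional K L] [Algebra.IsSeparable K L] (y : L) :
    ∃ p : Points K L, p.1.2 = y :=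
  ⟨(pointsEquiv K L).symm (⟨0, by simp⟩, y), rfl⟩

variable [Fintype K] [Fintype L]

lemma card_trace_fiber {q d : ℕ} (hK : Fintype.card K = q) (hL : Module.finrank K L = d + 1)
    (t : K) : Nat.card {x : L // Algebra.trace K L x = t} = q ^ d := by
  have hq : 0 < q := hK ▸ Fintype.card_pos
  have h := card_mul_card_trace_fiber K L t
  rw [Module.card_eq_pow_finrank (K := K) (V := L), hL, hK] at h
  apply Nat.eq_of_mul_eq_mul_left hq
  rw [h]
  ring

lemma card_points {q d : ℕ} (hK : Fintype.card K = q) (hL : Module.finrank K L = d + 1) :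
    Nat.card (Points K L) = q ^ (2 * d + 1) := by
  rw [Nat.card_congr (pointsEquiv K L), Nat.card_prod, card_trace_fiber hK hL,
    Nat.card_eq_fintype_card, Module.card_eq_pow_finrank (K := K) (V := L), hL, hK, ← pow_add]
  congr 1
  omega

lemma card_cols [DecidableEq L] {q d : ℕ} (hK : Fintype.card K = q) (hL : Module.finrank K L = d + 1) :
    Fintype.card (Cols (traceFun K L) (traceSqFun K L)) = q ^ (2 * d + 1) + 1 := by
  rw [Fintype.card_option, ← Nat.card_eq_fintype_card]
  congr 1
  exact card_points hK hL

lemma vecMulLinear_genMatrix_injective :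
    Function.Injective (genMatrix (traceFun K L) (traceSqFun K L)).vecMulLinear := by
  rw [← LinearMap.ker_eq_bot, LinearMap.ker_eq_bot']
  intro u hu
  have h1 : u 1 = 0 := by
    rw [← vecMul_genMatrix_none (f := traceFun K L) (g := traceSqFun K L) u, hu]
    rfl
  have h2 : ∀ y : L, u 0 + u 2 * y = 0 := by
    intro y
    obtain ⟨p, rfl⟩ := exists_point (K := K) y
    have := vecMul_genMatrix_some u p
    rw [hu, h1] at this
    simpa using this.symm
  have h0 : u 0 = 0 := by simpa using h2 0
  have h3 : u 2 = 0 := by simpa [h0] using h2 1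
  ext i
  fin_cases i <;> simpa

variable (K L) in
/-- The number of points `(x, y)` with `a + b x + c y = 0`. -/
noncomputable def lineCount (a b c : L) : ℕ :=
  Nat.card {p : Points K L // a + b * p.1.1 + c * p.1.2 = 0}

lemma hammingNorm_add_lineCount [DecidableEq L] {q d : ℕ} (hK : Fintype.card K = q)
    (hL : Module.finrank K L = d + 1) (u : Fin 3 → L) :
    hammingNorm ((genMatrix (traceFun K L) (traceSqFun K L)).vecMulLinear u) +
      lineCount K L (u 0) (u 1) (u 2) = q ^ (2 * d + 1) + if u 1 = 0 then 0 else 1 := by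
  rw [hammingNorm, ← card_points (K := K) (L := L) hK hL, lineCount, Nat.card_eq_fintype_card,
    Nat.card_eq_fintype_card, Fintype.card_subtype, ← card_univ (α := Points K L), card_filter,
    Fintype.sum_option, ← card_filter, vecMul_genMatrix_none]
  simp only [vecMul_genMatrix_some]
  have := card_filter_add_card_filter_not (s := (univ : Finset (Points K L)))
    (fun p => u 0 + u 1 * p.1.1 + u 2 * p.1.2 = 0)
  have h2 : (if u 1 ≠ 0 then 1 else 0) = if u 1 = 0 then 0 else 1 := by split_ifs <;> simp_all
  rw [← this, h2, add_assoc, add_comm]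
  refine congrArg₂ (· + ·) ?_ rfl
  rw [add_comm]

/-- The equation of the line determines `x` from `y`; substituting it into the trace condition
leaves a condition on `y` alone. -/
lemma lineCount_of_ne_zero {K L : Type*} [Field K] [Field L] [Algebra K L] (a c : L) {b : L} (hb : b ≠ 0) :
    lineCount K L a b c = zeroCount K (-a / b) (-c / b) := by
  refine Nat.card_congr
    { toFun := fun p => ⟨p.1.1.2, ?_⟩
      invFun := fun y => ⟨⟨((-a - c * y) / b, y), ?_⟩, ?_⟩
      left_inv := fun p => ?_
      right_inv := fun y => rfl }
  · have h1 := (trace_add_traceSq_eq_zero_iff _ _).1 p.1.2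
    rw [← h1]
    congr 1
    have h2 : p.1.1.1 = (-a - c * p.1.1.2) / b := by
      rw [eq_div_iff hb]
      linear_combination p.2
    rw [h2]
    ring
  · refine (trace_add_traceSq_eq_zero_iff _ _).2 (Eq.trans ?_ y.2)
    congr 1
    ring
  · simp only
    field_simp
    ring
  · ext
    · simp only
      rw [div_eq_iff hb]
      linear_combination -p.2
    · rfl

lemma lineCount_zero_of_ne_zero {q d : ℕ} (hK : Fintype.card K = q)
    (hL : Module.finrank K L = d + 1) (a : L) {c : L} (hc : c ≠ 0) :
    lineCount K L a 0 c = q ^ d := by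
  rw [← card_trace_fiber (K := K) (L := L) hK hL 0]
  refine Nat.card_congr
    { toFun := fun p => ⟨p.1.1.1 + p.1.1.2 ^ 2, (trace_add_traceSq_eq_zero_iff _ _).1 p.1.2⟩
      invFun := fun x => ⟨⟨(x - (-a / c) ^ 2, -a / c),
        (trace_add_traceSq_eq_zero_iff _ _).2 (by simp [x.2])⟩, ?_⟩
      left_inv := fun p => ?_
      right_inv := fun y => by simp }
  · simp only
    field_simp
    ring
  · have h2 : -a / c = p.1.1.2 := by
      rw [div_eq_iff hc]
      linear_combination -p.2
    ext
    · simp [h2]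
    · simp [h2]

lemma lineCount_zero_zero {K L : Type*} [Field K] [Field L] [Algebra K L] {a : L} (ha : a ≠ 0) : lineCount K L a 0 0 = 0 := by
  rw [lineCount, Nat.card_eq_zero]
  left
  exact ⟨fun p => ha (by simpa using p.2)⟩

/-- The weight enumerator of the code in terms of the counts `zeroCount`. -/
lemma sum_hammingNorm [DecidableEq L] {q d : ℕ} (hK : Fintype.card K = q)
    (hL : Module.finrank K L = d + 1) (f : ℤ → ℚ) :
    ∑ u, f (hammingNorm ((genMatrix (traceFun K L) (traceSqFun K L)).vecMulLinear u)) =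
      f 0 + (q ^ (d + 1) - 1) * f (q ^ (2 * d + 1)) +
        q ^ (d + 1) * (q ^ (d + 1) - 1) * f (q ^ (2 * d + 1) - q ^ d) +
        (q ^ (d + 1) - 1) * ∑ c : L, ∑ a : L, f (q ^ (2 * d + 1) + 1 - zeroCount K a c) := by
  have hcardL : Fintype.card L = q ^ (d + 1) := by
    rw [Module.card_eq_pow_finrank (K := K), hL, hK]
  have hq1 : 1 ≤ q ^ (d + 1) := hcardL ▸ Fintype.card_pos
  let w : (Fin 3 → L) → ℤ := fun u =>
    hammingNorm ((genMatrix (traceFun K L) (traceSqFun K L)).vecMulLinear u)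
  have hw : ∀ u, w u = q ^ (2 * d + 1) + (if u 1 = 0 then 0 else 1) -
      lineCount K L (u 0) (u 1) (u 2) := by
    intro u
    have h := hammingNorm_add_lineCount hK hL u
    have h' : w u + lineCount K L (u 0) (u 1) (u 2) =
        q ^ (2 * d + 1) + (if u 1 = 0 then 0 else 1) := by
      have := congrArg (Nat.cast : ℕ → ℤ) h
      push_cast at this
      exact this
    linarith
  let e : (Fin 3 → L) ≃ L × L × L :=
    { toFun := fun u => (u 1, u 2, u 0)
      invFun := fun r => ![r.2.2, r.1, r.2.1]
      left_inv := fun u => by ext i; fin_cases i <;> rfl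
      right_inv := fun r => rfl }
  have h1 : ∑ u, f (w u) = ∑ b : L, ∑ c : L, ∑ a : L, f (w ![a, b, c]) := by
    rw [← Fintype.sum_prod_type' fun b c => ∑ a : L, f (w ![a, b, c]), Fintype.sum_prod_type]
    simp only [← Fintype.sum_prod_type']
    exact Fintype.sum_equiv e _ _ fun u => by
      congr 2
      exact (e.symm_apply_apply u).symm
  have herase : ∀ g : L → ℚ, ∑ t, g t = g 0 + ∑ t ∈ univ.erase 0, g t := fun g =>
    (add_sum_erase univ g (mem_univ 0)).symm
  have hcardE : ((univ.erase (0 : L)).card : ℚ) = q ^ (d + 1) - 1 := by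
    rw [card_erase_of_mem (mem_univ _), card_univ, hcardL, Nat.cast_sub hq1]
    push_cast
    rfl
  have hb : ∀ b : L, b ≠ 0 → ∑ c : L, ∑ a : L, f (w ![a, b, c]) =
      ∑ c : L, ∑ a : L, f (q ^ (2 * d + 1) + 1 - zeroCount K a c) := by
    intro b hb
    -- Multiplication by `-b⁻¹` normalises the line and permutes the parameters `a` and `c`, so
    -- every `b ≠ 0` contributes the same sum.
    have hb' : -b⁻¹ ≠ 0 := neg_ne_zero.2 (inv_ne_zero hb)
    refine Fintype.sum_equiv (Equiv.mulRight₀ _ hb') _ _ fun c => ?_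
    refine Fintype.sum_equiv (Equiv.mulRight₀ _ hb') _ _ fun a => ?_
    rw [hw]
    have h2 : ∀ t : L, Equiv.mulRight₀ _ hb' t = -t / b := fun t => by
      rw [Equiv.mulRight₀_apply]
      ring
    simp [hb, lineCount_of_ne_zero, h2]
  have hc : ∀ c : L, c ≠ 0 → ∑ a : L, f (w ![a, 0, c]) =
      q ^ (d + 1) * f (q ^ (2 * d + 1) - q ^ d) := by
    intro c hc
    have h2 : ∀ a : L, w ![a, 0, c] = q ^ (2 * d + 1) - q ^ d := by
      intro a
      rw [hw]
      simp [lineCount_zero_of_ne_zero hK hL _ hc]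
    simp [h2, hcardL]
  have ha : ∀ a : L, a ≠ 0 → f (w ![a, 0, 0]) = f (q ^ (2 * d + 1)) := by
    intro a ha
    rw [hw]
    simp [lineCount_zero_zero ha]
  have h0 : w ![0, 0, 0] = 0 := by
    have : (![0, 0, 0] : Fin 3 → L) = 0 := by ext i; fin_cases i <;> rfl
    simp only [w, this, map_zero, hammingNorm_zero, Nat.cast_zero]
  change ∑ u, f (w u) = _
  rw [h1, herase, sum_congr rfl fun b hb' => hb b (ne_of_mem_erase hb'), sum_const,
    nsmul_eq_mul, hcardE, herase, sum_congr rfl fun c hc' => hc c (ne_of_mem_erase hc'), sum_const,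
    nsmul_eq_mul, hcardE, herase, sum_congr rfl fun a ha' => ha a (ne_of_mem_erase ha'), sum_const,
    nsmul_eq_mul, hcardE, h0]
  ring

end Weights

/-! ### From weight enumerators to tables, numbers of weights and minimum distance. -/

section Tables

variable {F ι : Type*} [Field F] [Fintype ι] [DecidableEq F]

lemma weightCount_range {M : Type*} [AddCommGroup M] [Module F M] [Fintype M]
    {φ : M →ₗ[F] ι → F} (hφ : Function.Injective φ) (w : ℕ) :
    weightCount (LinearMap.range φ) w = (univ.filter fun u => hammingNorm (φ u) = w).card := by
  classical
  have : {c : ι → F | c ∈ LinearMap.range φ ∧ hammingNorm c = w} =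
      ((univ.filter fun u => hammingNorm (φ u) = w).image φ : Finset (ι → F)) := by
    ext c
    simp only [Set.mem_ofPred_eq, LinearMap.mem_range, coe_image, coe_filter, mem_univ, true_and,
      Set.mem_image]
    constructor
    · rintro ⟨⟨u, rfl⟩, hu⟩
      exact ⟨u, hu, rfl⟩
    · rintro ⟨u, hu, rfl⟩
      exact ⟨⟨u, rfl⟩, hu⟩
  rw [weightCount, this, Set.ncard_coe_finset, card_image_of_injective _ hφ]

lemma sum_filter_map_snd (T : List (ℤ × ℚ)) (w : ℤ) :
    ((T.filter fun r => r.1 = w).map Prod.snd).sum =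
      (T.map fun r => r.2 * if r.1 = w then 1 else 0).sum := by
  induction T with
  | nil => simp
  | cons r T ih =>
    by_cases h : r.1 = w <;> simp [h, ih]

/-- Taking for `f` the indicator of a single weight reads off its multiplicity, with equal rows
already added. -/
lemma hasWeightTable_range {M : Type*} [AddCommGroup M] [Module F M] [Fintype M]
    {φ : M →ₗ[F] ι → F} (hφ : Function.Injective φ) {T : List (ℤ × ℚ)}
    (h : ∀ f : ℤ → ℚ, ∑ u, f (hammingNorm (φ u)) = (T.map fun r => r.2 * f r.1).sum) :
    HasWeightTable (LinearMap.range φ) T := by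
  intro w
  rw [sum_filter_map_snd, ← h fun s => if s = (w : ℤ) then 1 else 0, weightCount_range hφ,
    sum_boole]
  simp

variable {C : Submodule F (ι → F)} {T : List (ℤ × ℚ)}

/-- Positive multiplicities cannot cancel when rows of equal weight are added. -/
lemma weightCount_ne_zero_iff (hT : HasWeightTable C T) (hpos : ∀ r ∈ T, 0 < r.2) (w : ℕ) :
    weightCount C w ≠ 0 ↔ (w : ℤ) ∈ T.map Prod.fst := by
  have h := hT w
  have hnonneg : ∀ x ∈ (T.filter fun r => r.1 = (w : ℤ)).map Prod.snd, 0 ≤ x := by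
    intro x hx
    obtain ⟨r, hr, rfl⟩ := List.mem_map.1 hx
    exact (hpos r (List.mem_filter.1 hr).1).le
  rw [← Nat.cast_ne_zero (R := ℚ), h]
  constructor
  · intro hne
    by_contra hmem
    apply hne
    rw [List.filter_eq_nil_iff.2]
    · simp
    · intro r hr hrw
      exact hmem (List.mem_map.2 ⟨r, hr, by simpa using hrw⟩)
  · intro hmem
    obtain ⟨r, hr, hrw⟩ := List.mem_map.1 hmem
    have h1 := List.single_le_sum hnonneg r.2
      (List.mem_map.2 ⟨r, List.mem_filter.2 ⟨hr, by simpa using hrw⟩, rfl⟩)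
    exact ((hpos r hr).trans_le h1).ne'

lemma isWeightCode_card (hT : HasWeightTable C T) (hpos : ∀ r ∈ T, 0 < r.2) {S : Finset ℤ}
    (hS : ∀ s, s ∈ S ↔ s ∈ T.map Prod.fst ∧ s ≠ 0) (hS0 : ∀ s ∈ S, 0 ≤ s) :
    IsWeightCode C S.card := by
  rw [IsWeightCode]
  refine card_bij (fun w _ => (w : ℤ)) ?_ (fun _ _ _ _ h => by exact_mod_cast h) ?_
  · intro w hw
    rw [mem_filter, mem_Icc, weightCount_ne_zero_iff hT hpos] at hw
    exact (hS _).2 ⟨hw.2, by omega⟩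
  · intro s hs
    have h0 := hS0 s hs
    obtain ⟨w, rfl⟩ := Int.eq_ofNat_of_zero_le h0
    have h1 := (hS _).1 hs
    have h2 := (weightCount_ne_zero_iff hT hpos w).2 h1.1
    refine ⟨w, ?_, rfl⟩
    rw [mem_filter, mem_Icc]
    refine ⟨⟨by omega, ?_⟩, h2⟩
    obtain ⟨c, -, hc⟩ := Set.nonempty_of_ncard_ne_zero h2
    rw [← hc]
    exact hammingNorm_le_card_fintype

lemma hasMinDist_of_table [Finite F] (hT : HasWeightTable C T) (hpos : ∀ r ∈ T, 0 < r.2) {d : ℕ}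
    (hd : 0 < d) (hdT : (d : ℤ) ∈ T.map Prod.fst)
    (hle : ∀ s ∈ T.map Prod.fst, s ≠ 0 → (d : ℤ) ≤ s) : HasMinDist C d := by
  constructor
  · obtain ⟨c, hc, hcd⟩ := Set.nonempty_of_ncard_ne_zero
      ((weightCount_ne_zero_iff hT hpos d).2 hdT)
    refine ⟨c, hc, 0, C.zero_mem, ?_, ?_⟩
    · rintro rfl
      rw [hammingNorm_zero] at hcd
      omega
    · rw [hammingDist_zero_right, hcd]
  · rintro _ ⟨c, hc, c', hc', hne, rfl⟩
    rw [hammingDist_comm, hammingDist_eq_hammingNorm, neg_add_eq_sub]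
    have h1 : hammingNorm (c - c') ≠ 0 := hammingNorm_ne_zero_iff.2 (sub_ne_zero.2 hne)
    have h2 : weightCount C (hammingNorm (c - c')) ≠ 0 :=
      Set.ncard_ne_zero_of_mem (a := c - c') ⟨C.sub_mem hc hc', rfl⟩ (Set.toFinite _)
    have h3 := hle _ ((weightCount_ne_zero_iff hT hpos _).1 h2) (by exact_mod_cast h1)
    exact_mod_cast h3

end Tables

/-! ### The dual code: dimension and minimum distance. -/

section Dual

lemma mem_dual_code_iff {L : Type*} [Field L] {f g : L → L} [Fintype (Cols f g)]
    (z : Cols f g → L) :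
    z ∈ dual (code f g) ↔ (genMatrix f g).mulVec z = 0 := by
  have h : ∀ u : Fin 3 → L, z ⬝ᵥ (genMatrix f g).vecMulLinear u = u ⬝ᵥ (genMatrix f g).mulVec z := by
    intro u
    rw [Matrix.dotProduct_mulVec, dotProduct_comm]
    rfl
  constructor
  · intro hz
    refine dotProduct_eq_zero_iff.1 fun u => ?_
    rw [dotProduct_comm, ← h]
    exact hz _ ⟨u, rfl⟩
  · rintro hz _ ⟨u, rfl⟩
    rw [h, hz, dotProduct_zero]

/-- The dual is the kernel of the generator matrix, so this is rank-nullity together with equality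
of row and column rank. -/
lemma finrank_dual_code {L : Type*} [Field L] {f g : L → L} [Fintype (Cols f g)] :
    Module.finrank L (dual (code f g)) + Module.finrank L (code f g) =
      Fintype.card (Cols f g) := by
  have h1 : dual (code f g) = LinearMap.ker (genMatrix f g).mulVecLin := by
    ext z
    rw [mem_dual_code_iff, LinearMap.mem_ker, Matrix.mulVecLin_apply]
  have h2 : Module.finrank L (code f g) =
      Module.finrank L (LinearMap.range (genMatrix f g).mulVecLin) := by
    have := Matrix.rank_transpose (genMatrix f g)
    rwa [Matrix.rank, Matrix.rank, Matrix.mulVecLin_transpose] at this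
  rw [h1, h2, add_comm, LinearMap.finrank_range_add_finrank_ker, Module.finrank_fintype_fun_eq_card]

/-- Any two columns of the generator matrix are separated by a codeword. -/
lemma exists_codeword_separating {L : Type*} [Field L] {f g : L → L} (i j : Cols f g) :
    ∃ u : Fin 3 → L, (genMatrix f g).vecMulLinear u i ≠ 0 ∧
      (j ≠ i → (genMatrix f g).vecMulLinear u j = 0) := by
  rcases i with _ | p <;> rcases j with _ | p'
  · exact ⟨![0, 1, 0], by simp [vecMul_genMatrix_none], fun h => absurd rfl h⟩
  · exact ⟨![-p'.1.1, 1, 0], by simp [vecMul_genMatrix_none],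
      fun _ => by simp [vecMul_genMatrix_some]⟩
  · exact ⟨![1, 0, 0], by simp [vecMul_genMatrix_some], fun _ => by simp [vecMul_genMatrix_none]⟩
  · by_cases hx : p.1.1 = p'.1.1
    · by_cases hy : p.1.2 = p'.1.2
      · have : p = p' := Subtype.ext (Prod.ext hx hy)
        subst this
        exact ⟨![1, 0, 0], by simp [vecMul_genMatrix_some], fun h => absurd rfl h⟩
      · refine ⟨![-p'.1.2, 0, 1], ?_, fun _ => by simp [vecMul_genMatrix_some]⟩
        simpa [vecMul_genMatrix_some, neg_add_eq_zero] using fun h => hy h.symm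
    · refine ⟨![-p'.1.1, 1, 0], ?_, fun _ => by simp [vecMul_genMatrix_some]⟩
      simpa [vecMul_genMatrix_some, neg_add_eq_zero] using fun h => hx h.symm

/-- If the support of `z` were contained in `{i, j}` with `z i ≠ 0`, a codeword that vanishes at `j`
but not at `i` would not be orthogonal to `z`. -/
lemma three_le_hammingNorm_of_mem_dual {L : Type*} [Field L] [DecidableEq L] {f g : L → L}
    [Fintype (Cols f g)] {z : Cols f g → L} (hz : z ∈ dual (code f g)) (h0 : z ≠ 0) :
    3 ≤ hammingNorm z := by
  classical
  by_contra hlt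
  obtain ⟨i, hi⟩ := Function.ne_iff.1 h0
  rw [Pi.zero_apply] at hi
  have hcard : ((univ.filter fun k => z k ≠ 0).erase i).card ≤ 1 := by
    have h1 : (univ.filter fun k => z k ≠ 0).card < 3 := not_le.1 hlt
    rw [card_erase_of_mem (by simpa using hi)]
    omega
  have : Nonempty (Cols f g) := ⟨i⟩
  obtain ⟨j, hj⟩ := card_le_one_iff_subset_singleton.1 hcard
  obtain ⟨u, hui, huj⟩ := exists_codeword_separating i j
  have h := hz _ ⟨u, rfl⟩
  rw [dotProduct, sum_eq_single i] at h
  · exact (mul_ne_zero hi hui) h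
  · intro k _ hk
    by_cases hzk : z k = 0
    · rw [hzk, zero_mul]
    · have hkj : k = j := by simpa using hj (mem_erase.2 ⟨hk, by simpa using hzk⟩)
      rw [hkj, huj (hkj ▸ hk), mul_zero]
  · simp

lemma hasMinDist_dual_code {K L : Type*} [Field K] [Fintype K] [Field L] [Fintype L]
    [DecidableEq L] [Algebra K L] (hL : 2 ≤ Module.finrank K L) :
    HasMinDist (dual (code (traceFun K L) (traceSqFun K L))) 3 := by
  constructor
  · obtain ⟨d, hd⟩ : ∃ d, Module.finrank K L = d + 1 := ⟨Module.finrank K L - 1, by omega⟩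
    have hcard := card_trace_fiber (K := K) (L := L) rfl hd 0
    have h1 : 1 < Nat.card {x : L // Algebra.trace K L x = 0} := by
      rw [hcard]
      exact Nat.one_lt_pow (by omega) Fintype.one_lt_card
    have : Nontrivial {x : L // Algebra.trace K L x = 0} := Finite.one_lt_card_iff_nontrivial.1 h1
    obtain ⟨⟨x, hx⟩, hx0⟩ := exists_ne (⟨0, map_zero _⟩ : {x : L // Algebra.trace K L x = 0})
    have hx0' : x ≠ 0 := fun h => hx0 (Subtype.ext h)
    let p0 : Points K L := ⟨(0, 0), (trace_add_traceSq_eq_zero_iff _ _).2 (by simp)⟩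
    let p1 : Points K L := ⟨(x, 0), (trace_add_traceSq_eq_zero_iff _ _).2 (by simp [hx])⟩
    have hp : p0 ≠ p1 := fun h => hx0' (congrArg (fun p => p.1.1) h).symm
    -- Encodes the relation `x (0,1,0) + (1,0,0) - (1,x,0) = 0` between columns; a nonzero `x` of
    -- trace zero exists because the degree is at least two.
    let z : Cols (traceFun K L) (traceSqFun K L) → L :=
      Pi.single none x + Pi.single (some p0) 1 - Pi.single (some p1) 1
    have hz : z ∈ dual (code (traceFun K L) (traceSqFun K L)) := by
      rintro _ ⟨u, rfl⟩
      simp only [z, sub_dotProduct, add_dotProduct, single_dotProduct, vecMul_genMatrix_none,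
        vecMul_genMatrix_some, p0, p1]
      ring
    have hnorm : hammingNorm z = 3 := by
      have : (univ.filter fun k => z k ≠ 0) = {none, some p0, some p1} := by
        ext k
        rcases k with _ | p
        · simp [z, hx0']
        · by_cases h0 : p = p0
          · subst h0
            simp [z, Pi.single_apply, hp]
          · by_cases h1 : p = p1
            · subst h1
              simp [z, Pi.single_apply, h0]
            · simp [z, Pi.single_apply, h0, h1]
      rw [hammingNorm]
      convert congrArg Finset.card this
      rw [card_insert_of_notMem (by simp), card_pair (by simpa using hp)]
    refine ⟨z, hz, 0, Submodule.zero_mem _, ?_, by rw [hammingDist_zero_right, hnorm]⟩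
    rw [← hammingNorm_ne_zero_iff, hnorm]
    norm_num
  · rintro _ ⟨c, hc, c', hc', hne, rfl⟩
    rw [hammingDist_comm, hammingDist_eq_hammingNorm, neg_add_eq_sub]
    exact three_le_hammingNorm_of_mem_dual (Submodule.sub_mem _ hc hc') (sub_ne_zero.2 hne)

end Dual

/-! ### The three cases: weight tables and coincidences among the weights. -/

section Enumerators

variable {K L : Type*} [Field K] [Fintype K] [Field L] [Fintype L] [DecidableEq L] [Algebra K L]

lemma hasParams_code {q d : ℕ} (hK : Fintype.card K = q) (hL : Module.finrank K L = d + 1) :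
    HasParams (code (traceFun K L) (traceSqFun K L)) (q ^ (2 * d + 1) + 1) 3 := by
  refine ⟨card_cols hK hL, ?_⟩
  rw [code, LinearMap.finrank_range_of_inj vecMulLinear_genMatrix_injective,
    Module.finrank_fintype_fun_eq_card, Fintype.card_fin]

lemma hasWeightTable_of_even {q d : ℕ} (hK : Fintype.card K = q) (hq : Even q)
    (hL : Module.finrank K L = d + 1) :
    HasWeightTable (code (traceFun K L) (traceSqFun K L))
      [(0, 1),
       (q ^ (2 * d + 1) - 2 * q ^ d + 1, q ^ (d + 1) / 2 * (q ^ (d + 1) - 1) * (q - 1)),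
       (q ^ (2 * d + 1) - q ^ d, q ^ (d + 1) * (q ^ (d + 1) - 1)),
       (q ^ (2 * d + 1) - q ^ d + 1,
          q ^ (d + 1) * (q ^ (d + 1) - 1) * (q ^ (d + 1) - q + 1)),
       (q ^ (2 * d + 1), q ^ (d + 1) - 1),
       (q ^ (2 * d + 1) + 1, q ^ (d + 1) / 2 * (q ^ (d + 1) - 1) * (q - 1))] := by
  refine hasWeightTable_range vecMulLinear_genMatrix_injective fun f => ?_
  rw [sum_hammingNorm hK hL, sum_zeroCount_of_even hK hq hL fun s => f (q ^ (2 * d + 1) + 1 - s)]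
  simp only [List.map_cons, List.map_nil, List.sum_cons, List.sum_nil]
  rw [sub_zero, add_sub_right_comm _ 1 ((q : ℤ) ^ d), add_sub_right_comm _ 1 (2 * (q : ℤ) ^ d)]
  ring

lemma hasWeightTable_of_odd_of_odd {q j : ℕ} (hK : Fintype.card K = q) (hq : Odd q)
    (hL : Module.finrank K L = 2 * j + 1) :
    HasWeightTable (code (traceFun K L) (traceSqFun K L))
      [(0, 1),
       (q ^ (2 * (2 * j) + 1) - q ^ (2 * j) - q ^ j + 1,
          q ^ (2 * (2 * j) + 1) * (q ^ (2 * j + 1) - 1) * (q - 1) / 2),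
       (q ^ (2 * (2 * j) + 1) - q ^ (2 * j), q ^ (2 * j + 1) * (q ^ (2 * j + 1) - 1)),
       (q ^ (2 * (2 * j) + 1) - q ^ (2 * j) + 1,
          q ^ (2 * (2 * j) + 1) * (q ^ (2 * j + 1) - 1)),
       (q ^ (2 * (2 * j) + 1) - q ^ (2 * j) + q ^ j + 1,
          q ^ (2 * (2 * j) + 1) * (q ^ (2 * j + 1) - 1) * (q - 1) / 2),
       (q ^ (2 * (2 * j) + 1), q ^ (2 * j + 1) - 1)] := by
  refine hasWeightTable_range vecMulLinear_genMatrix_injective fun f => ?_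
  rw [sum_hammingNorm hK hL,
    sum_zeroCount_of_odd hK hq hL fun s => f (q ^ (2 * (2 * j) + 1) + 1 - s),
    sum_traceSqCount_odd hK hq hL fun s => f (q ^ (2 * (2 * j) + 1) + 1 - s)]
  simp only [List.map_cons, List.map_nil, List.sum_cons, List.sum_nil]
  generalize (q : ℤ) ^ (2 * (2 * j) + 1) = A
  generalize (q : ℤ) ^ (2 * j) = B
  generalize (q : ℤ) ^ j = r
  rw [show A + 1 - B = A - B + 1 by ring, show A + 1 - (B + r) = A - B - r + 1 by ring,
    show A + 1 - (B - r) = A - B + r + 1 by ring]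
  ring

lemma hasWeightTable_of_odd_of_even {q j : ℕ} {e : ℤ} (hK : Fintype.card K = q) (hq : Odd q)
    (hL : Module.finrank K L = 2 * j + 1 + 1) (he : (-1) ^ ((q ^ (j + 1) - 1) / 2) = e) :
    HasWeightTable (code (traceFun K L) (traceSqFun K L))
      [(0, 1),
       (q ^ (2 * (2 * j + 1) + 1) - q ^ (2 * j + 1) + (q - 1) * q ^ j * e + 1,
          q ^ (2 * (2 * j + 1) + 1) * (q ^ (2 * j + 1 + 1) - 1)),
       (q ^ (2 * (2 * j + 1) + 1) - q ^ (2 * j + 1) + q ^ j * (-e) + 1,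
          (q ^ (2 * (2 * j + 1 + 1)) - q ^ (2 * (2 * j + 1) + 1)) * (q ^ (2 * j + 1 + 1) - 1)),
       (q ^ (2 * (2 * j + 1) + 1) - q ^ (2 * j + 1),
          q ^ (2 * j + 1 + 1) * (q ^ (2 * j + 1 + 1) - 1)),
       (q ^ (2 * (2 * j + 1) + 1), q ^ (2 * j + 1 + 1) - 1)] := by
  classical
  refine hasWeightTable_range vecMulLinear_genMatrix_injective fun f => ?_
  have hq1 : 1 ≤ q := hK ▸ Fintype.card_pos
  have hM : ∀ t : K, (traceSqCount K L t : ℤ) = q ^ (2 * j + 1) + e * q ^ j -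
      if t = 0 then e * (q : ℤ) ^ (j + 1) else 0 := by
    intro t
    have := traceSqCount_even (k := j + 1) hK hq j.succ_pos (hL.trans (by ring)) t
    rwa [he, Nat.add_sub_cancel, show 2 * (j + 1) - 1 = 2 * j + 1 by omega] at this
  rw [sum_hammingNorm hK hL,
    sum_zeroCount_of_odd hK hq hL fun s => f (q ^ (2 * (2 * j + 1) + 1) + 1 - s),
    ← add_sum_erase univ _ (mem_univ (0 : K)), hM, if_pos rfl,
    sum_congr rfl (g := fun _ => f (q ^ (2 * (2 * j + 1) + 1) + 1 - (q ^ (2 * j + 1) + e * q ^ j)))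
      fun t ht => by rw [hM, if_neg (ne_of_mem_erase ht), sub_zero],
    sum_const, card_erase_of_mem (mem_univ _), card_univ, hK, nsmul_eq_mul, Nat.cast_sub hq1]
  simp only [List.map_cons, List.map_nil, List.sum_cons, List.sum_nil]
  rw [pow_succ (q : ℤ) j]
  generalize (q : ℤ) ^ (2 * (2 * j + 1) + 1) = A
  generalize (q : ℤ) ^ (2 * j + 1) = B
  generalize (q : ℤ) ^ j = r
  rw [show A + 1 - (B + e * r - e * (r * q)) = A - B + (q - 1) * r * e + 1 by ring,
    show A + 1 - (B + e * r) = A - B + r * -e + 1 by ring]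
  push_cast
  ring

/-- The quadratic character of `-1` in terms of the exponent. -/
lemma neg_one_pow_half_prime_pow {p : ℕ} (hp : Odd p) (N : ℕ) :
    (-1 : ℤ) ^ ((p ^ N - 1) / 2) = (-1) ^ (N * ((p - 1) / 2)) := by
  obtain ⟨s, rfl⟩ := hp
  -- Modulo `4`, `(1 + 2s)^N ≡ 1 + 2 N s`, which fixes the parity of `(p^N - 1) / 2`.
  have h : ∀ N, ∃ x, (2 * s + 1) ^ N = 4 * x + 1 + 2 * (N * s) := by
    intro N
    induction N with
    | zero => exact ⟨0, by simp⟩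
    | succ N ih =>
      obtain ⟨x, hx⟩ := ih
      refine ⟨x * (2 * s + 1) + N * s * s, ?_⟩
      rw [pow_succ, hx]
      ring
  obtain ⟨x, hx⟩ := h N
  have h1 : ((2 * s + 1) ^ N - 1) / 2 = 2 * x + N * s := by omega
  have h2 : (2 * s + 1 - 1) / 2 = s := by omega
  rw [h1, h2, pow_add, pow_mul, neg_one_sq, one_pow, one_mul]

lemma weights_of_even {q d : ℕ} (hK : Fintype.card K = q) (hq : Even q) (hd : 1 ≤ d)
    (hL : Module.finrank K L = d + 1) :
    IsWeightCode (code (traceFun K L) (traceSqFun K L)) 5 ∧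
    HasMinDist (code (traceFun K L) (traceSqFun K L)) (q ^ (2 * d + 1) - 2 * q ^ d + 1) := by
  have hT := hasWeightTable_of_even hK hq hL
  have hq2 : 2 ≤ q := hK ▸ Fintype.one_lt_card
  have hpos : ∀ r ∈ ([(0, 1),
       (q ^ (2 * d + 1) - 2 * q ^ d + 1, q ^ (d + 1) / 2 * (q ^ (d + 1) - 1) * (q - 1)),
       (q ^ (2 * d + 1) - q ^ d, q ^ (d + 1) * (q ^ (d + 1) - 1)),
       (q ^ (2 * d + 1) - q ^ d + 1,
          q ^ (d + 1) * (q ^ (d + 1) - 1) * (q ^ (d + 1) - q + 1)),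
       (q ^ (2 * d + 1), q ^ (d + 1) - 1),
       (q ^ (2 * d + 1) + 1, q ^ (d + 1) / 2 * (q ^ (d + 1) - 1) * (q - 1))] : List (ℤ × ℚ)),
      0 < r.2 := by
    have h1 : (q : ℚ) ≤ q ^ (d + 1) := by exact_mod_cast Nat.le_self_pow (by omega) q
    have h2 : (2 : ℚ) ≤ q := by exact_mod_cast hq2
    generalize (q : ℚ) ^ (d + 1) = X at *
    have h3 : 0 < X := by linarith
    have h4 : 0 < X - 1 := by linarith
    have h5 : 0 < (q : ℚ) - 1 := by linarith
    have h6 : 0 < X - q + 1 := by linarith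
    simp only [List.forall_mem_cons]
    refine ⟨by positivity, by positivity, by positivity, by positivity, h4, by positivity, ?_⟩
    simp
  have hB : 2 ≤ q ^ d := hq2.trans (Nat.le_self_pow (by omega) q)
  -- With `A = q^(2d+1)` and `B = q^d`, the bounds `B ≥ 2` and `A ≥ 4B` suffice to separate and
  -- order the weights, and to keep the subtraction in `ℕ` from truncating.
  have hA : 4 * q ^ d ≤ q ^ (2 * d + 1) := by
    have : q ^ (2 * d + 1) = q * q ^ d * q ^ d := by ring
    rw [this]
    exact Nat.mul_le_mul_right _ (Nat.mul_le_mul hq2 hB)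
  zify at hA hB
  constructor
  · have hS := isWeightCode_card (S := {(q : ℤ) ^ (2 * d + 1) - 2 * q ^ d + 1,
      (q : ℤ) ^ (2 * d + 1) - q ^ d, (q : ℤ) ^ (2 * d + 1) - q ^ d + 1, (q : ℤ) ^ (2 * d + 1),
      (q : ℤ) ^ (2 * d + 1) + 1}) hT hpos
    simp only [List.map_cons, List.map_nil, List.mem_cons, List.not_mem_nil, or_false,
      mem_insert, mem_singleton] at hS
    generalize (q : ℤ) ^ (2 * d + 1) = A at *
    generalize (q : ℤ) ^ d = B at *
    convert hS (fun s => by omega) (fun s => by omega)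
    rw [card_insert_of_notMem, card_insert_of_notMem, card_insert_of_notMem, card_pair] <;>
      simp only [ne_eq, mem_insert, mem_singleton] <;> omega
  · have hcast : ((q ^ (2 * d + 1) - 2 * q ^ d + 1 : ℕ) : ℤ) =
        q ^ (2 * d + 1) - 2 * q ^ d + 1 := by
      rw [Nat.cast_add, Nat.cast_sub (by zify; linarith)]
      push_cast
      rfl
    refine hasMinDist_of_table hT hpos (Nat.succ_pos _) ?_ ?_ <;> rw [hcast] <;>
      simp only [List.map_cons, List.map_nil, List.mem_cons, List.not_mem_nil, or_false]
    · simp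
    · generalize (q : ℤ) ^ (2 * d + 1) = A at *
      generalize (q : ℤ) ^ d = B at *
      intro s
      omega

lemma weights_of_odd_of_odd {q j : ℕ} (hK : Fintype.card K = q) (hq : Odd q) (hj : 1 ≤ j)
    (hL : Module.finrank K L = 2 * j + 1) :
    IsWeightCode (code (traceFun K L) (traceSqFun K L)) 5 ∧
    HasMinDist (code (traceFun K L) (traceSqFun K L))
      (q ^ (2 * (2 * j) + 1) - q ^ (2 * j) - q ^ j + 1) := by
  have hT := hasWeightTable_of_odd_of_odd hK hq hL
  have hq2 : 2 ≤ q := hK ▸ Fintype.one_lt_card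
  have hq3 : 3 ≤ q := by
    obtain ⟨s, hs⟩ := hq
    omega
  have hpos : ∀ r ∈ ([(0, 1),
       (q ^ (2 * (2 * j) + 1) - q ^ (2 * j) - q ^ j + 1,
          q ^ (2 * (2 * j) + 1) * (q ^ (2 * j + 1) - 1) * (q - 1) / 2),
       (q ^ (2 * (2 * j) + 1) - q ^ (2 * j), q ^ (2 * j + 1) * (q ^ (2 * j + 1) - 1)),
       (q ^ (2 * (2 * j) + 1) - q ^ (2 * j) + 1,
          q ^ (2 * (2 * j) + 1) * (q ^ (2 * j + 1) - 1)),
       (q ^ (2 * (2 * j) + 1) - q ^ (2 * j) + q ^ j + 1,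
          q ^ (2 * (2 * j) + 1) * (q ^ (2 * j + 1) - 1) * (q - 1) / 2),
       (q ^ (2 * (2 * j) + 1), q ^ (2 * j + 1) - 1)] : List (ℤ × ℚ)), 0 < r.2 := by
    have h1 : (q : ℚ) ≤ q ^ (2 * j + 1) := by exact_mod_cast Nat.le_self_pow (by omega) q
    have h2 : (2 : ℚ) ≤ q := by exact_mod_cast hq2
    have h0 : (0 : ℚ) < q := by linarith
    have h7 : (0 : ℚ) < q ^ (2 * (2 * j) + 1) := by positivity
    have h3 : (0 : ℚ) < q ^ (2 * j + 1) := by positivity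
    have h4 : 0 < (q : ℚ) ^ (2 * j + 1) - 1 := by linarith
    have h5 : 0 < (q : ℚ) - 1 := by linarith
    simp only [List.forall_mem_cons]
    refine ⟨by positivity, by positivity, by positivity, by positivity, by positivity, h4, ?_⟩
    simp
  have hr : 3 ≤ q ^ j := hq3.trans (Nat.le_self_pow (by omega) q)
  have hB : 3 * q ^ j ≤ q ^ (2 * j) := by
    have : q ^ (2 * j) = q ^ j * q ^ j := by ring
    rw [this]
    exact Nat.mul_le_mul_right _ hr
  have hA : 3 * q ^ (2 * j) ≤ q ^ (2 * (2 * j) + 1) := by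
    have : q ^ (2 * (2 * j) + 1) = q ^ (2 * j + 1) * q ^ (2 * j) := by ring
    rw [this]
    exact Nat.mul_le_mul_right _ (hq3.trans (Nat.le_self_pow (by omega) q))
  zify at hA hB hr
  constructor
  · have hS := isWeightCode_card (S := {(q : ℤ) ^ (2 * (2 * j) + 1) - q ^ (2 * j) - q ^ j + 1,
      (q : ℤ) ^ (2 * (2 * j) + 1) - q ^ (2 * j), (q : ℤ) ^ (2 * (2 * j) + 1) - q ^ (2 * j) + 1,
      (q : ℤ) ^ (2 * (2 * j) + 1) - q ^ (2 * j) + q ^ j + 1,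
      (q : ℤ) ^ (2 * (2 * j) + 1)}) hT hpos
    simp only [List.map_cons, List.map_nil, List.mem_cons, List.not_mem_nil, or_false,
      mem_insert, mem_singleton] at hS
    generalize (q : ℤ) ^ (2 * (2 * j) + 1) = A at *
    generalize (q : ℤ) ^ (2 * j) = B at *
    generalize (q : ℤ) ^ j = r at *
    convert hS (fun s => by omega) (fun s => by omega)
    rw [card_insert_of_notMem, card_insert_of_notMem, card_insert_of_notMem, card_pair] <;>
      simp only [ne_eq, mem_insert, mem_singleton] <;> omega
  · have hcast : ((q ^ (2 * (2 * j) + 1) - q ^ (2 * j) - q ^ j + 1 : ℕ) : ℤ) =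
        q ^ (2 * (2 * j) + 1) - q ^ (2 * j) - q ^ j + 1 := by
      rw [Nat.cast_add, Nat.sub_sub, Nat.cast_sub (by zify; linarith)]
      push_cast
      ring
    refine hasMinDist_of_table hT hpos (Nat.succ_pos _) ?_ ?_ <;> rw [hcast] <;>
      simp only [List.map_cons, List.map_nil, List.mem_cons, List.not_mem_nil, or_false]
    · simp
    · generalize (q : ℤ) ^ (2 * (2 * j) + 1) = A at *
      generalize (q : ℤ) ^ (2 * j) = B at *
      generalize (q : ℤ) ^ j = r at *
      intro s
      omega

lemma weights_of_odd_of_even {q j : ℕ} (hK : Fintype.card K = q) (hq : Odd q)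
    (hL : Module.finrank K L = 2 * j + 1 + 1) :
    (¬ (j = 0 ∧ q % 4 = 1) → IsWeightCode (code (traceFun K L) (traceSqFun K L)) 4) ∧
    (j = 0 ∧ q % 4 = 1 → IsWeightCode (code (traceFun K L) (traceSqFun K L)) 2) := by
  obtain ⟨e, he⟩ : ∃ e : ℤ, (-1) ^ ((q ^ (j + 1) - 1) / 2) = e := ⟨_, rfl⟩
  have hT := hasWeightTable_of_odd_of_even hK hq hL he
  have hq2 : 2 ≤ q := hK ▸ Fintype.one_lt_card
  have hq3 : 3 ≤ q := by
    obtain ⟨s, hs⟩ := hq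
    omega
  have hpos : ∀ r ∈ ([(0, 1),
       (q ^ (2 * (2 * j + 1) + 1) - q ^ (2 * j + 1) + (q - 1) * q ^ j * e + 1,
          q ^ (2 * (2 * j + 1) + 1) * (q ^ (2 * j + 1 + 1) - 1)),
       (q ^ (2 * (2 * j + 1) + 1) - q ^ (2 * j + 1) + q ^ j * (-e) + 1,
          (q ^ (2 * (2 * j + 1 + 1)) - q ^ (2 * (2 * j + 1) + 1)) * (q ^ (2 * j + 1 + 1) - 1)),
       (q ^ (2 * (2 * j + 1) + 1) - q ^ (2 * j + 1),
          q ^ (2 * j + 1 + 1) * (q ^ (2 * j + 1 + 1) - 1)),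
       (q ^ (2 * (2 * j + 1) + 1), q ^ (2 * j + 1 + 1) - 1)] : List (ℤ × ℚ)), 0 < r.2 := by
    have h1 : (q : ℚ) ≤ q ^ (2 * j + 1 + 1) := by exact_mod_cast Nat.le_self_pow (by omega) q
    have h2 : (2 : ℚ) ≤ q := by exact_mod_cast hq2
    have h0 : (0 : ℚ) < q := by linarith
    have h7 : (0 : ℚ) < q ^ (2 * (2 * j + 1) + 1) := by positivity
    have h3 : (0 : ℚ) < q ^ (2 * j + 1 + 1) := by positivity
    have h4 : 0 < (q : ℚ) ^ (2 * j + 1 + 1) - 1 := by linarith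
    have h5 : 0 < (q : ℚ) ^ (2 * (2 * j + 1 + 1)) - q ^ (2 * (2 * j + 1) + 1) := by
      have : (q : ℚ) ^ (2 * (2 * j + 1 + 1)) - q ^ (2 * (2 * j + 1) + 1) =
        q ^ (2 * (2 * j + 1) + 1) * (q - 1) := by ring
      rw [this]
      exact mul_pos h7 (by linarith)
    simp only [List.forall_mem_cons]
    refine ⟨by positivity, by positivity, by positivity, by positivity, h4, ?_⟩
    simp
  have hX : 3 * q ^ j ≤ q * q ^ j := Nat.mul_le_mul_right _ hq3
  have hr : 1 ≤ q ^ j := Nat.one_le_pow _ _ (by omega)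
  have hBeq : q ^ (2 * j + 1) = q ^ j * (q * q ^ j) := by ring
  have hB : q * q ^ j ≤ q ^ (2 * j + 1) := by
    rw [hBeq]
    exact Nat.le_mul_of_pos_left _ hr
  have hA : 3 * q ^ (2 * j + 1) ≤ q ^ (2 * (2 * j + 1) + 1) := by
    have : q ^ (2 * (2 * j + 1) + 1) = q ^ (2 * j + 1 + 1) * q ^ (2 * j + 1) := by ring
    rw [this]
    exact Nat.mul_le_mul_right _ (hq3.trans (Nat.le_self_pow (by omega) q))
  -- For `j ≥ 1` the powers are far enough apart to separate the weights. For `j = 0` one has `r =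
  -- 1` and `B = X = q`; then `e = 1` turns the first two nonzero weights into `A` and `A - B`,
  -- which are the last two.
  have hcases : (3 ≤ q ^ j ∧ 3 * (q * q ^ j) ≤ q ^ (2 * j + 1) ∧ 1 ≤ j) ∨
      (q ^ j = 1 ∧ q ^ (2 * j + 1) = q * q ^ j ∧ j = 0) := by
    rcases Nat.eq_zero_or_pos j with rfl | hj
    · right
      simp
    · left
      have : 3 ≤ q ^ j := hq3.trans (Nat.le_self_pow (by omega) q)
      refine ⟨this, ?_, hj⟩
      rw [hBeq]
      exact Nat.mul_le_mul_right _ this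
  have hesq : (e = 1 ∨ e = -1) ∧ (j = 0 → (q % 4 = 1 ↔ e = 1)) := by
    refine ⟨he ▸ neg_one_pow_eq_or ℤ _, ?_⟩
    rintro rfl
    rw [zero_add, pow_one] at he
    rcases Nat.odd_mod_four_iff.1 (Nat.odd_iff.1 hq) with h | h
    · rw [Even.neg_one_pow (Nat.even_iff.2 (by omega))] at he
      omega
    · rw [Odd.neg_one_pow (Nat.odd_iff.2 (by omega))] at he
      omega
  have hS := fun S : Finset ℤ => isWeightCode_card (S := S) hT hpos
  simp only [List.map_cons, List.map_nil, List.mem_cons, List.not_mem_nil, or_false,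
    sub_mul, one_mul] at hS
  zify at hA hB hr hX hcases
  clear hT hpos hBeq he
  generalize (q : ℤ) ^ (2 * (2 * j + 1) + 1) = A at *
  generalize (q : ℤ) ^ (2 * j + 1) = B at *
  generalize (q : ℤ) * (q : ℤ) ^ j = X at *
  generalize (q : ℤ) ^ j = r at *
  obtain ⟨rfl | rfl, he⟩ := hesq
  · constructor
    · intro hne
      convert hS {A - B + (X - r) * 1 + 1, A - B + r * -1 + 1, A - B, A}
        (fun s => by simp only [mem_insert, mem_singleton]; omega)
        (fun s => by simp only [mem_insert, mem_singleton]; omega)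
      rw [card_insert_of_notMem, card_insert_of_notMem, card_pair] <;>
        simp only [ne_eq, mem_insert, mem_singleton] <;> omega
    · intro heq
      convert hS {A - B, A}
        (fun s => by simp only [mem_insert, mem_singleton]; omega)
        (fun s => by simp only [mem_insert, mem_singleton]; omega)
      rw [card_pair]
      omega
  · constructor
    · intro hne
      convert hS {A - B + (X - r) * -1 + 1, A - B + r * - -1 + 1, A - B, A}
        (fun s => by simp only [mem_insert, mem_singleton]; omega)
        (fun s => by simp only [mem_insert, mem_singleton]; omega)
      rw [card_insert_of_notMem, card_insert_of_notMem, card_pair] <;>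
        simp only [ne_eq, mem_insert, mem_singleton] <;> omega
    · intro heq
      have := (he heq.1).1 heq.2
      omega

end Enumerators

end LinearCode

/-! ### Assembly, with the exponents in terms of `m`, `l` and `p`. -/

theorem theorem2 (p l m q : ℕ) (hp : p.Prime) (hq : q = p ^ l) (hm : 2 ≤ m)
    (K L : Type*) [Field K] [Fintype K] [Field L] [Fintype L] [DecidableEq L] [Algebra K L]
    (hK : Fintype.card K = q) (hL : Module.finrank K L = m)
    (C : Submodule L
      (LinearCode.Cols (LinearCode.traceFun K L) (LinearCode.traceSqFun K L) → L))
    (hC : C = LinearCode.code (LinearCode.traceFun K L) (LinearCode.traceSqFun K L)) :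
    -- `q` even
    (Even q →
      LinearCode.IsWeightCode C 5 ∧
      LinearCode.HasParams C (q ^ (2 * m - 1) + 1) 3 ∧
      LinearCode.HasMinDist C (q ^ (2 * m - 1) - 2 * q ^ (m - 1) + 1) ∧
      LinearCode.HasWeightTable C
        [(0, 1),
         (q ^ (2 * m - 1) - 2 * q ^ (m - 1) + 1, q ^ m / 2 * (q ^ m - 1) * (q - 1)),
         (q ^ (2 * m - 1) - q ^ (m - 1), q ^ m * (q ^ m - 1)),
         (q ^ (2 * m - 1) - q ^ (m - 1) + 1, q ^ m * (q ^ m - 1) * (q ^ m - q + 1)),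
         (q ^ (2 * m - 1), q ^ m - 1),
         (q ^ (2 * m - 1) + 1, q ^ m / 2 * (q ^ m - 1) * (q - 1))]) ∧
    -- `q` and `m` odd
    (Odd q → Odd m →
      LinearCode.IsWeightCode C 5 ∧
      LinearCode.HasParams C (q ^ (2 * m - 1) + 1) 3 ∧
      LinearCode.HasMinDist C (q ^ (2 * m - 1) - q ^ (m - 1) - q ^ ((m - 1) / 2) + 1) ∧
      LinearCode.HasWeightTable C
        [(0, 1),
         (q ^ (2 * m - 1) - q ^ (m - 1) - q ^ ((m - 1) / 2) + 1,
            q ^ (2 * m - 1) * (q ^ m - 1) * (q - 1) / 2),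
         (q ^ (2 * m - 1) - q ^ (m - 1), q ^ m * (q ^ m - 1)),
         (q ^ (2 * m - 1) - q ^ (m - 1) + 1, q ^ (2 * m - 1) * (q ^ m - 1)),
         (q ^ (2 * m - 1) - q ^ (m - 1) + q ^ ((m - 1) / 2) + 1,
            q ^ (2 * m - 1) * (q ^ m - 1) * (q - 1) / 2),
         (q ^ (2 * m - 1), q ^ m - 1)]) ∧
    -- `q` odd, `m` even; the rows of the table have distinct weights
    -- unless `m = 2` and `q ≡ 1 (mod 4)`
    (Odd q → Even m →
      (¬ (m = 2 ∧ q ≡ 1 [MOD 4]) → LinearCode.IsWeightCode C 4) ∧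
      (m = 2 ∧ q ≡ 1 [MOD 4] → LinearCode.IsWeightCode C 2) ∧
      LinearCode.HasParams C (q ^ (2 * m - 1) + 1) 3 ∧
      LinearCode.HasWeightTable C
        [(0, 1),
         (q ^ (2 * m - 1) - q ^ (m - 1)
              + (q - 1) * q ^ ((m - 2) / 2) * (-1) ^ (l * m * (p - 1) / 4) + 1,
            q ^ (2 * m - 1) * (q ^ m - 1)),
         (q ^ (2 * m - 1) - q ^ (m - 1)
              + q ^ ((m - 2) / 2) * (-1) ^ ((l * m * (p - 1) + 4) / 4) + 1,
            (q ^ (2 * m) - q ^ (2 * m - 1)) * (q ^ m - 1)),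
         (q ^ (2 * m - 1) - q ^ (m - 1), q ^ m * (q ^ m - 1)),
         (q ^ (2 * m - 1), q ^ m - 1)]) ∧
    -- the dual code
    LinearCode.HasParams (LinearCode.dual C) (q ^ (2 * m - 1) + 1) (q ^ (2 * m - 1) - 2) ∧
    LinearCode.HasMinDist (LinearCode.dual C) 3 ∧
    LinearCode.IsAlmostMDS (LinearCode.dual C) := by
  have hq_pow := hq
  subst hC
  obtain ⟨d, rfl⟩ : ∃ d, m = d + 1 := ⟨m - 1, by omega⟩
  have hd : 1 ≤ d := by omega
  have hlen : 2 * (d + 1) - 1 = 2 * d + 1 := by omega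
  rw [hlen, Nat.add_sub_cancel]
  have hparams := LinearCode.hasParams_code hK hL
  have hn : 2 ≤ q ^ (2 * d + 1) :=
    (hK ▸ Fintype.one_lt_card : 1 < q).trans_le (Nat.le_self_pow (by omega) q)
  have hdual := LinearCode.finrank_dual_code
    (f := LinearCode.traceFun K L) (g := LinearCode.traceSqFun K L)
  rw [hparams.1, hparams.2] at hdual
  have hmin := LinearCode.hasMinDist_dual_code (K := K) (L := L) (hL ▸ hm)
  refine ⟨fun hq => ?_, fun hq hm => ?_, fun hq hm => ?_, ⟨hparams.1, by omega⟩, hmin,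
    3, hmin, by rw [hparams.1]; omega⟩
  · obtain ⟨h1, h2⟩ := LinearCode.weights_of_even hK hq hd hL
    exact ⟨h1, hparams, h2, LinearCode.hasWeightTable_of_even hK hq hL⟩
  · obtain ⟨j, hj⟩ := hm
    obtain rfl : d = 2 * j := by omega
    rw [Nat.mul_div_cancel_left j two_pos]
    obtain ⟨h1, h2⟩ := LinearCode.weights_of_odd_of_odd hK hq (by omega) hL
    exact ⟨h1, hparams, h2, LinearCode.hasWeightTable_of_odd_of_odd hK hq hL⟩
  · obtain ⟨k, hk⟩ := hm
    obtain ⟨j, rfl⟩ : ∃ j, k = j + 1 := ⟨k - 1, by omega⟩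
    obtain rfl : d = 2 * j + 1 := by omega
    obtain ⟨h1, h2⟩ := LinearCode.weights_of_odd_of_even hK hq hL
    have hcond : (2 * j + 1 + 1 = 2 ∧ q ≡ 1 [MOD 4]) ↔ (j = 0 ∧ q % 4 = 1) := by
      rw [Nat.ModEq]
      omega
    rw [hcond]
    refine ⟨h1, h2, hparams, ?_⟩
    have hl : l ≠ 0 := by
      rintro rfl
      rw [hq_pow, pow_zero] at hn
      simp at hn
    have hpodd : Odd p := by
      rw [hq_pow] at hq
      exact (Nat.odd_pow_iff hl).1 hq
    -- The division by `4` is exact: both `m = 2(j + 1)` and `p - 1` are even.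
    have hexp : l * (2 * j + 1 + 1) * (p - 1) / 4 = l * (j + 1) * ((p - 1) / 2) := by
      obtain ⟨s, rfl⟩ := hpodd
      have h3 : (2 * s + 1 - 1) / 2 = s := by omega
      have h4 : l * (2 * j + 1 + 1) * (2 * s + 1 - 1) = l * (j + 1) * s * 4 := by
        rw [Nat.add_sub_cancel]
        ring
      rw [h3, h4, Nat.mul_div_cancel _ (by norm_num)]
    have hsign : (-1 : ℤ) ^ ((q ^ (j + 1) - 1) / 2) =
        (-1) ^ (l * (2 * j + 1 + 1) * (p - 1) / 4) := by
      rw [hq_pow, ← pow_mul, LinearCode.neg_one_pow_half_prime_pow hpodd, hexp]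
    have hhalf : (2 * j + 1 + 1 - 2) / 2 = j := by omega
    -- The `+ 4` in the exponent adds one after division, which produces the opposite sign `-e`.
    rw [Nat.add_div_right _ (by norm_num), pow_succ (-1 : ℤ), mul_neg_one, hhalf]
    exact LinearCode.hasWeightTable_of_odd_of_even hK hq hL hsign
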